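/- An exact category is an additive category $\mathcal A$ with a family of kernel–cokernel pairs $A\overset{i}{\rightarrowtail} B\overset{p}{\twoheadrightarrow} C$ (the exact sequences; the maps $i$ are called admissible monomorphisms, the maps $p$ admissible epimorphisms), closed under isomorphism, such that identities of zero objects are admissible epimorphisms, admissible epimorphisms are closed under composition, pullbacks of admissible epimorphisms along arbitrary morphisms exist and are admissible epimorphisms, and pushouts of admissible monomorphisms along arbitrary morphisms exist and are admissible monomorphisms. An exact functor is an additive functor that preserves exact sequences. For an exact category $\mathcal A$ let $S_\bullet(\mathcal A)$ be the simplicial groupoid with $S_n(\mathcal A)$ the full subgroupoid of the maximal subgroupoid of $\operatorname{Fun}(\operatorname{Ar}[n],\mathcal A)$, where $\operatorname{Ar}[n]=\operatorname{Fun}([1],[n])$ is the poset of pairs $i\le j$ in $[n]$, on the diagrams $(a_{ij})$ such that each $a_{ii}$ is a zero object, all horizontal maps $a_{ij}\to a_{il}$ are admissible monomorphisms, all vertical maps $a_{ij}\to a_{kj}$ are admissible epimorphisms, and all squares with corners $a_{ij},a_{il},a_{kj},a_{kl}$ ($i\le k\le j\le l$) are bicartesian. For a simplicial object $X$ let $P^{\triangleleft}X$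 be the simplicial object with $(P^{\triangleleft}X)_n=X_{n+1}$ obtained by precomposing $X$ with $[n]\mapsto[0]\star[n]$, and let $d_0\colon P^{\triangleleft}X\to X$ be given by the extra face maps. For an exact functor $f\colon\mathcal A\to\mathcal B$ the relative $S_\bullet$-construction is the (strict, levelwise) pullback of simplicial groupoids $$S^{\mathrm{rel}}_\bullet(f)=P^{\triangleleft}S_\bullet(\mathcal B)\times_{S_\bullet(\mathcal B)}S_\bullet(\mathcal A)$$ of $d_0\colon P^{\triangleleft}S_\bullet(\mathcal B)\to S_\bullet(\mathcal B)$ and $S_\bullet(f)\colon S_\bullet(\mathcal A)\to S_\bullet(\mathcal B)$. A simplicial groupoid $X$ is called $2$-Segal if for every $n\ge2$ and every triangulation $T$ of the convex $(n+1)$-gon with vertices $0,\dots,n$, the canonical functor from $X_n$ to $X_T$ is an equivalence of groupoids. Here $\Delta^T\subset\Delta[n]$ is the simplicial subset formed by the triangles of $T$, and $X_T$ is the homotopy limit (pseudo-limit) of the groupoids $X_m$ over the category of simplices $\Delta[m]\to\Delta^T$. **Corollary.** For every exact functor $f\colon\mathcal A\to\mathcal B$ between exact categories, the simplicial groupoid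 $S^{\mathrm{rel}}_\bullet(f)$ is $2$-Segal. -/

import Mathlib

open CategoryTheory CategoryTheory.Limits Opposite

universe w v u

namespace RelSdot

section ExactCategories

/-- The morphisms occurring as the first map of a sequence of the family `S`. -/
def admMono {C : Type u} [Category.{v} C] [Preadditive C]
    (S : ObjectProperty (ShortComplex C)) : MorphismProperty C :=
  fun _ Y i => ∃ (Z : C) (p : Y ⟶ Z) (w : i ≫ p = 0), S (ShortComplex.mk i p w)

/-- The morphisms occurring as the second map of a sequence of the family `S`. -/
def admEpi {C : Type u} [Category.{v} C] [Preadditive C]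
    (S : ObjectProperty (ShortComplex C)) : MorphismProperty C :=
  fun Y _ p => ∃ (X : C) (i : X ⟶ Y) (w : i ≫ p = 0), S (ShortComplex.mk i p w)

/-- The structure of an exact category (Keller's axioms) on an additive category `C`:
a family of exact sequences, i.e. kernel-cokernel pairs, satisfying the usual closure axioms. -/
class ExactCategory (C : Type u) [Category.{v} C] [Preadditive C] [HasFiniteBiproducts C] where
  /-- the distinguished family of exact sequences -/
  exactSeq : ObjectProperty (ShortComplex C)
  isKernel : ∀ T : ShortComplex C, exactSeq T →
    Nonempty (IsLimit (KernelFork.ofι T.f T.zero))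
  isCokernel : ∀ T : ShortComplex C, exactSeq T →
    Nonempty (IsColimit (CokernelCofork.ofπ T.g T.zero))
  closed_iso : ∀ T T' : ShortComplex C, Nonempty (T ≅ T') → exactSeq T → exactSeq T'
  id_zero : ∀ Z : C, IsZero Z → admEpi exactSeq (𝟙 Z)
  comp_epi : ∀ {X Y Z : C} (p : X ⟶ Y) (q : Y ⟶ Z),
    admEpi exactSeq p → admEpi exactSeq q → admEpi exactSeq (p ≫ q)
  pullback_epi : ∀ {X Y' X' : C} (f : X ⟶ X') (p' : Y' ⟶ X'), admEpi exactSeq p' →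
    ∃ (Y : C) (f' : Y ⟶ Y') (p : Y ⟶ X), IsPullback f' p p' f ∧ admEpi exactSeq p
  pushout_mono : ∀ {X X' Y : C} (g : X ⟶ X') (i : X ⟶ Y), admMono exactSeq i →
    ∃ (Y' : C) (g' : Y ⟶ Y') (i' : X' ⟶ Y'), IsPushout i g g' i' ∧ admMono exactSeq i'

/-- The admissible monomorphisms of an exact category. -/
def adMono (C : Type u) [Category.{v} C] [Preadditive C] [HasFiniteBiproducts C]
    [ExactCategory C] : MorphismProperty C :=
  admMono (ExactCategory.exactSeq (C := C))

/-- The admissible epimorphisms of an exact category. -/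
def adEpi (C : Type u) [Category.{v} C] [Preadditive C] [HasFiniteBiproducts C]
    [ExactCategory C] : MorphismProperty C :=
  admEpi (ExactCategory.exactSeq (C := C))

/-- An exact functor: an additive functor that preserves the exact sequences. -/
class ExactFunctor {A B : Type u} [Category.{v} A] [Preadditive A] [HasFiniteBiproducts A]
    [ExactCategory A] [Category.{v} B] [Preadditive B] [HasFiniteBiproducts B]
    [ExactCategory B] (F : A ⥤ B) : Prop extends F.Additive where
  map_exactSeq : ∀ T : ShortComplex A,
    ExactCategory.exactSeq T → ExactCategory.exactSeq (T.map F)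

end ExactCategories

section ExactFunctorLemmas

variable {C : Type u} [Category.{v} C] [Preadditive C]

lemma isPullback_of_rows {X Y Z W Q : C} {i : X ⟶ Y} {p : X ⟶ Z} {q : Y ⟶ W} {j : Z ⟶ W}
    {a : Y ⟶ Q} {b : W ⟶ Q} (sq : i ≫ q = p ≫ j) (hab : q ≫ b = a)
    (w₁ : i ≫ a = 0) (w₂ : j ≫ b = 0)
    (h₁ : IsLimit (KernelFork.ofι i w₁)) (h₂ : IsLimit (KernelFork.ofι j w₂)) :
    IsPullback i p q j := by
  have mi : Mono i := ⟨fun f g h => Fork.IsLimit.hom_ext h₁ (by simpa using h)⟩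
  have mj : Mono j := ⟨fun f g h => Fork.IsLimit.hom_ext h₂ (by simpa using h)⟩
  have key : ∀ s : PullbackCone q j, s.fst ≫ a = 0 := fun s => by
    rw [← hab, ← Category.assoc, s.condition, Category.assoc, w₂, comp_zero]
  have hl : ∀ s : PullbackCone q j,
      (KernelFork.IsLimit.lift' h₁ s.fst (key s)).1 ≫ i = s.fst :=
    fun s => (KernelFork.IsLimit.lift' h₁ s.fst (key s)).2
  refine ⟨⟨sq⟩, ⟨PullbackCone.IsLimit.mk sq
    (fun s => (KernelFork.IsLimit.lift' h₁ s.fst (key s)).1) hl ?_ ?_⟩⟩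
  · intro s
    rw [← cancel_mono j, Category.assoc, ← sq, ← Category.assoc, hl, s.condition]
  · intro s m hm _
    rw [← cancel_mono i, hm, hl]

lemma isPushout_of_cols {X Y Z W K : C} {i : X ⟶ Y} {p : X ⟶ Z} {q : Y ⟶ W} {j : Z ⟶ W}
    {a : K ⟶ X} {b : K ⟶ Y} (sq : i ≫ q = p ≫ j) (hab : a ≫ i = b)
    (w₁ : a ≫ p = 0) (w₂ : b ≫ q = 0)
    (h₁ : IsColimit (CokernelCofork.ofπ p w₁)) (h₂ : IsColimit (CokernelCofork.ofπ q w₂)) :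
    IsPushout i p q j := by
  have ep : Epi p := ⟨fun f g h => Cofork.IsColimit.hom_ext h₁ (by simpa using h)⟩
  have eq : Epi q := ⟨fun f g h => Cofork.IsColimit.hom_ext h₂ (by simpa using h)⟩
  have key : ∀ s : PushoutCocone i p, b ≫ s.inl = 0 := fun s => by
    rw [← hab, Category.assoc, s.condition, ← Category.assoc, w₁, zero_comp]
  have hl : ∀ s : PushoutCocone i p,
      q ≫ (CokernelCofork.IsColimit.desc' h₂ s.inl (key s)).1 = s.inl :=
    fun s => (CokernelCofork.IsColimit.desc' h₂ s.inl (key s)).2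
  refine ⟨⟨sq⟩, ⟨PushoutCocone.IsColimit.mk sq
    (fun s => (CokernelCofork.IsColimit.desc' h₂ s.inl (key s)).1) hl ?_ ?_⟩⟩
  · intro s
    rw [← cancel_epi p, ← Category.assoc, ← sq, Category.assoc, hl, s.condition]
  · intro s m hm _
    rw [← cancel_epi q, hm, hl]

variable {A B : Type u} [Category.{v} A] [Preadditive A] [HasFiniteBiproducts A]
    [ExactCategory A] [Category.{v} B] [Preadditive B] [HasFiniteBiproducts B]
    [ExactCategory B] (F : A ⥤ B) [ExactFunctor F]

lemma ExactFunctor.map_adMono {X Y : A} {i : X ⟶ Y} (h : adMono A i) :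
    adMono B (F.map i) := by
  obtain ⟨Z, p, w, h⟩ := h
  exact ⟨_, _, _, ExactFunctor.map_exactSeq (F := F) _ h⟩

lemma ExactFunctor.map_adEpi {X Y : A} {p : X ⟶ Y} (h : adEpi A p) :
    adEpi B (F.map p) := by
  obtain ⟨Z, i, w, h⟩ := h
  exact ⟨_, _, _, ExactFunctor.map_exactSeq (F := F) _ h⟩

/-- In an exact category, for a pushout square with admissible monomorphisms `i`, `j`,
any exact sequence starting with `i` induces one starting with `j`. -/
lemma exists_exactSeq_right {X Y Z W : A} {i : X ⟶ Y} {p : X ⟶ Z} {q : Y ⟶ W} {j : Z ⟶ W}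
    (hi : adMono A i) (hj : adMono A j) (sq : IsPushout i p q j) :
    ∃ (Q : A) (b : W ⟶ Q) (w₁ : i ≫ q ≫ b = 0) (w₂ : j ≫ b = 0),
      ExactCategory.exactSeq (ShortComplex.mk i (q ≫ b) w₁) ∧
      ExactCategory.exactSeq (ShortComplex.mk j b w₂) := by
  obtain ⟨Q, a, w, ha⟩ := hi
  obtain ⟨Q', b', w', hb'⟩ := hj
  obtain ⟨ca⟩ := ExactCategory.isCokernel _ ha
  obtain ⟨cb'⟩ := ExactCategory.isCokernel _ hb'
  have hw : i ≫ a = p ≫ (0 : Z ⟶ Q) := by rw [w, comp_zero]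
  let b : W ⟶ Q := sq.desc a 0 hw
  have hb₁ : q ≫ b = a := sq.inl_desc _ _ _
  have hb₂ : j ≫ b = 0 := sq.inr_desc _ _ _
  have key : ∀ {T : A} (k : W ⟶ T) (_ : j ≫ k = 0), i ≫ q ≫ k = 0 := fun k hk => by
    rw [← Category.assoc, sq.w, Category.assoc, hk, comp_zero]
  have cb : IsColimit (CokernelCofork.ofπ b hb₂) := by
    refine CokernelCofork.IsColimit.ofπ b hb₂
      (fun k hk => (CokernelCofork.IsColimit.desc' ca (q ≫ k) (key k hk)).1) ?_ ?_
    · intro T k hk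
      have hl : a ≫ (CokernelCofork.IsColimit.desc' ca (q ≫ k) (key k hk)).1 = q ≫ k :=
        (CokernelCofork.IsColimit.desc' ca (q ≫ k) (key k hk)).2
      apply sq.hom_ext
      · rw [← Category.assoc, hb₁, hl]
      · rw [← Category.assoc, hb₂, hk, zero_comp]
    · intro T k hk m hm
      refine Cofork.IsColimit.hom_ext ca ?_
      refine Eq.trans ?_ (CokernelCofork.IsColimit.desc' ca (q ≫ k) (key k hk)).2.symm
      change a ≫ m = q ≫ k
      rw [← hm, ← hb₁, Category.assoc]
  let e : Q' ≅ Q := cb'.coconePointUniqueUpToIso cb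
  have he : b' ≫ e.hom = b := cb'.comp_coconePointUniqueUpToIso_hom cb WalkingParallelPair.one
  refine ⟨Q, b, by rw [hb₁, w], hb₂, ?_, ?_⟩
  · simpa only [hb₁] using ha
  · let E : ShortComplex.mk j b' w' ≅ ShortComplex.mk j b hb₂ :=
      ShortComplex.isoMk (Iso.refl _) (Iso.refl _) e (by simp) (by simp [he])
    exact ExactCategory.closed_iso _ _ ⟨E⟩ hb'

/-- The dual statement for pullback squares and admissible epimorphisms. -/
lemma exists_exactSeq_left {X Y Z W : A} {i : X ⟶ Y} {p : X ⟶ Z} {q : Y ⟶ W} {j : Z ⟶ W}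
    (hp : adEpi A p) (hq : adEpi A q) (sq : IsPullback i p q j) :
    ∃ (K : A) (a : K ⟶ X) (w₁ : a ≫ p = 0) (w₂ : (a ≫ i) ≫ q = 0),
      ExactCategory.exactSeq (ShortComplex.mk a p w₁) ∧
      ExactCategory.exactSeq (ShortComplex.mk (a ≫ i) q w₂) := by
  obtain ⟨K', a', w', ha'⟩ := hp
  obtain ⟨K, b, w, hb⟩ := hq
  obtain ⟨ka'⟩ := ExactCategory.isKernel _ ha'
  obtain ⟨kb⟩ := ExactCategory.isKernel _ hb
  have hw : b ≫ q = (0 : K ⟶ Z) ≫ j := by rw [w, zero_comp]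
  let a : K ⟶ X := sq.lift b 0 hw
  have ha₁ : a ≫ i = b := sq.lift_fst _ _ _
  have ha₂ : a ≫ p = 0 := sq.lift_snd _ _ _
  have key : ∀ {T : A} (k : T ⟶ X) (_ : k ≫ p = 0), (k ≫ i) ≫ q = 0 := fun k hk => by
    rw [Category.assoc, sq.w, ← Category.assoc, hk, zero_comp]
  have ka : IsLimit (KernelFork.ofι a ha₂) := by
    refine KernelFork.IsLimit.ofι a ha₂
      (fun k hk => (KernelFork.IsLimit.lift' kb (k ≫ i) (key k hk)).1) ?_ ?_
    · intro T k hk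
      have hl : (KernelFork.IsLimit.lift' kb (k ≫ i) (key k hk)).1 ≫ b = k ≫ i :=
        (KernelFork.IsLimit.lift' kb (k ≫ i) (key k hk)).2
      apply sq.hom_ext
      · rw [Category.assoc, ha₁, hl]
      · rw [Category.assoc, ha₂, hk, comp_zero]
    · intro T k hk m hm
      refine Fork.IsLimit.hom_ext kb ?_
      refine Eq.trans ?_ (KernelFork.IsLimit.lift' kb (k ≫ i) (key k hk)).2.symm
      change m ≫ b = k ≫ i
      rw [← hm, ← ha₁, Category.assoc]
  let e : K' ≅ K := ka'.conePointUniqueUpToIso ka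
  have he : e.hom ≫ a = a' :=
    ka'.conePointUniqueUpToIso_hom_comp ka WalkingParallelPair.zero
  refine ⟨K, a, ha₂, by rw [ha₁, w], ?_, ?_⟩
  · let E : ShortComplex.mk a' p w' ≅ ShortComplex.mk a p ha₂ :=
      ShortComplex.isoMk e (Iso.refl _) (Iso.refl _) (by simp [he]) (by simp)
    exact ExactCategory.closed_iso _ _ ⟨E⟩ ha'
  · simpa only [ha₁] using hb

/-- An exact functor preserves bicartesian squares whose horizontal maps are admissible
monomorphisms and whose vertical maps are admissible epimorphisms. -/
lemma ExactFunctor.map_bicartesian {X Y Z W : A} {i : X ⟶ Y} {p : X ⟶ Z} {q : Y ⟶ W}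
    {j : Z ⟶ W} (hi : adMono A i) (hj : adMono A j) (hp : adEpi A p) (hq : adEpi A q)
    (sq : BicartesianSq i p q j) :
    BicartesianSq (F.map i) (F.map p) (F.map q) (F.map j) := by
  have hw : F.map i ≫ F.map q = F.map p ≫ F.map j := by
    rw [← F.map_comp, ← F.map_comp, sq.w]
  obtain ⟨Q, b, w₁, w₂, h₁, h₂⟩ := exists_exactSeq_right hi hj sq.toIsPushout
  obtain ⟨K, a, w₃, w₄, h₃, h₄⟩ := exists_exactSeq_left hp hq sq.toIsPullback
  obtain ⟨k₁⟩ := ExactCategory.isKernel _ (ExactFunctor.map_exactSeq (F := F) _ h₁)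
  obtain ⟨k₂⟩ := ExactCategory.isKernel _ (ExactFunctor.map_exactSeq (F := F) _ h₂)
  obtain ⟨c₃⟩ := ExactCategory.isCokernel _ (ExactFunctor.map_exactSeq (F := F) _ h₃)
  obtain ⟨c₄⟩ := ExactCategory.isCokernel _ (ExactFunctor.map_exactSeq (F := F) _ h₄)
  exact BicartesianSq.of_isPullback_isPushout
    (isPullback_of_rows hw (F.map_comp q b).symm _ _ k₁ k₂)
    (isPushout_of_cols hw (F.map_comp a i).symm _ _ c₃ c₄)

end ExactFunctorLemmas

section Sdot

/-- The category `Ar[n] = Fun([1],[n])`, as the poset of pairs `i ≤ j` in `[n]`. -/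
abbrev Ar (n : SimplexCategory) : Type :=
  {p : Fin (n.len + 1) × Fin (n.len + 1) // p.1 ≤ p.2}

namespace Ar

variable {n : SimplexCategory}

/-- The object `(i,j)` of `Ar[n]`. -/
abbrev mk (i j : Fin (n.len + 1)) (h : i ≤ j) : Ar n := ⟨(i, j), h⟩

/-- The horizontal morphism `(i,j) ⟶ (i,l)` of `Ar[n]`. -/
def hor (i j l : Fin (n.len + 1)) (hij : i ≤ j) (hjl : j ≤ l) :
    mk i j hij ⟶ mk i l (hij.trans hjl) :=
  homOfLE ⟨le_rfl, hjl⟩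

/-- The vertical morphism `(i,j) ⟶ (k,j)` of `Ar[n]`. -/
def ver (i k j : Fin (n.len + 1)) (hik : i ≤ k) (hkj : k ≤ j) :
    mk i j (hik.trans hkj) ⟶ mk k j hkj :=
  homOfLE ⟨hik, le_rfl⟩

/-- The functor `Ar[m] ⥤ Ar[n]` induced by a monotone map `[m] ⟶ [n]`. -/
def map {m n : SimplexCategory} (α : m ⟶ n) : Ar m ⥤ Ar n :=
  Monotone.functor
    (f := fun p : Ar m => mk (α.toOrderHom p.1.1) (α.toOrderHom p.1.2)
      (α.toOrderHom.monotone p.2))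
    (fun _ _ h => ⟨α.toOrderHom.monotone h.1, α.toOrderHom.monotone h.2⟩)

end Ar

variable (A : Type u) [Category.{v} A] [Preadditive A] [HasFiniteBiproducts A] [ExactCategory A]

/-- The `Ar[n]`-diagrams with diagonal entries zero objects, horizontal maps admissible
monomorphisms, vertical maps admissible epimorphisms and all squares bicartesian. -/
structure IsSdot {n : SimplexCategory} (D : Ar n ⥤ A) : Prop where
  zero : ∀ i, IsZero (D.obj (Ar.mk i i le_rfl))
  mono : ∀ i j l (hij : i ≤ j) (hjl : j ≤ l), adMono A (D.map (Ar.hor i j l hij hjl))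
  epi : ∀ i k j (hik : i ≤ k) (hkj : k ≤ j), adEpi A (D.map (Ar.ver i k j hik hkj))
  square : ∀ i k j l (hik : i ≤ k) (hkj : k ≤ j) (hjl : j ≤ l),
    BicartesianSq
      (D.map (Ar.hor i j l (hik.trans hkj) hjl))
      (D.map (Ar.ver i k j hik hkj))
      (D.map (Ar.ver i k l hik (hkj.trans hjl)))
      (D.map (Ar.hor k j l hkj hjl))

variable {A} in
lemma IsSdot.comp_map {m n : SimplexCategory} (α : m ⟶ n) {D : Ar n ⥤ A} (h : IsSdot A D) :
    IsSdot A (Ar.map α ⋙ D) where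
  zero i := h.zero _
  mono i j l hij hjl :=
    h.mono _ _ _ (α.toOrderHom.monotone hij) (α.toOrderHom.monotone hjl)
  epi i k j hik hkj :=
    h.epi _ _ _ (α.toOrderHom.monotone hik) (α.toOrderHom.monotone hkj)
  square i k j l hik hkj hjl :=
    h.square _ _ _ _ (α.toOrderHom.monotone hik) (α.toOrderHom.monotone hkj)
      (α.toOrderHom.monotone hjl)

/-- The property `IsSdot` as a property of objects of the functor category. -/
def sdotProp (n : SimplexCategory) : ObjectProperty (Ar n ⥤ A) := fun D => IsSdot A D

/-- The simplicial groupoid `S_•(A)`: in degree `n` it is the full subgroupoid of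
`Fun(Ar[n], A)_iso` on the diagrams satisfying `IsSdot`. -/
def sdot : SimplicialObject Grpd.{v, max u v} where
  obj n := Grpd.of (Core (sdotProp A n.unop).FullSubcategory)
  map {n m} α := Functor.core ((sdotProp A m.unop).lift
    ((sdotProp A n.unop).ι ⋙ (Functor.whiskeringLeft _ _ A).obj (Ar.map α.unop))
    (fun D => D.property.comp_map α.unop))
  map_id _ := rfl
  map_comp _ _ := rfl

variable {A}
variable {B : Type u} [Category.{v} B] [Preadditive B] [HasFiniteBiproducts B] [ExactCategory B]

lemma IsSdot.comp_functor {n : SimplexCategory} {D : Ar n ⥤ A} (h : IsSdot A D)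
    (F : A ⥤ B) [ExactFunctor F] : IsSdot B (D ⋙ F) where
  zero i := F.map_isZero (h.zero i)
  mono i j l hij hjl := ExactFunctor.map_adMono F (h.mono i j l hij hjl)
  epi i k j hik hkj := ExactFunctor.map_adEpi F (h.epi i k j hik hkj)
  square i k j l hik hkj hjl := ExactFunctor.map_bicartesian F (h.mono _ _ _ _ _)
    (h.mono _ _ _ _ _) (h.epi _ _ _ _ _) (h.epi _ _ _ _ _) (h.square i k j l hik hkj hjl)

/-- The map of simplicial groupoids `S_•(F)` given by postcomposition with `F`. -/
def sdotMap (F : A ⥤ B) [ExactFunctor F] : sdot A ⟶ sdot B where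
  app n := Functor.core ((sdotProp B n.unop).lift
    ((sdotProp A n.unop).ι ⋙ (Functor.whiskeringRight _ _ _).obj F)
    (fun D => D.property.comp_functor F))
  naturality _ _ _ := rfl

end Sdot

section PathObject

/-- The functor `[n] ↦ [0] ⋆ [n] = [n+1]` on the simplex category: a monotone map `α` goes
to the map with `0 ↦ 0` and `i + 1 ↦ α i + 1`. -/
def coneFunctor : SimplexCategory ⥤ SimplexCategory where
  obj n := SimplexCategory.mk (n.len + 1)
  map {m n} α := SimplexCategory.mkHom
    { toFun := Fin.cases 0 (fun i => (α.toOrderHom i).succ)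
      monotone' := by
        intro i j h
        induction i using Fin.cases with
        | zero => exact Fin.zero_le _
        | succ i =>
          induction j using Fin.cases with
          | zero => exact absurd h (by simp)
          | succ j =>
            exact Fin.succ_le_succ_iff.2 (α.toOrderHom.monotone (Fin.succ_le_succ_iff.1 h)) }
  map_id n := by
    ext i : 3
    induction i using Fin.cases <;> rfl
  map_comp α β := by
    ext i : 3
    induction i using Fin.cases <;> rfl

/-- The natural map `[n] ⟶ [0] ⋆ [n]`, `i ↦ i + 1`. -/
def coneIncl : 𝟭 SimplexCategory ⟶ coneFunctor where
  app n := SimplexCategory.δ (n := n.len) 0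
  naturality _ _ _ := rfl

variable {C : Type u} [Category.{v} C]

/-- The initial path object of a simplicial object. -/
def initialPath (X : SimplicialObject C) : SimplicialObject C := coneFunctor.op ⋙ X

/-- The map from the initial path object given in each degree by the face map `d₀`. -/
def initialPathD₀ (X : SimplicialObject C) : initialPath X ⟶ X where
  app n := X.map (coneIncl.app n.unop).op
  naturality m n α := by
    change X.map _ ≫ X.map _ = X.map _ ≫ X.map _
    rw [← X.map_comp, ← X.map_comp]
    exact congrArg X.map (congrArg Quiver.Hom.op (coneIncl.naturality α.unop))

end PathObject

section StrictPullback

/-- Objects of the strict pullback of groupoids. -/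
@[ext]
structure GrpdPullback {X Y Z : Grpd.{v, u}} (f : X ⟶ Z) (g : Y ⟶ Z) : Type u where
  fst : X
  snd : Y
  eq : f.obj fst = g.obj snd

namespace GrpdPullback

variable {X Y Z : Grpd.{v, u}} {f : X ⟶ Z} {g : Y ⟶ Z}

/-- Morphisms of the strict pullback of groupoids. -/
@[ext]
structure Hom (p q : GrpdPullback f g) : Type v where
  fst : p.fst ⟶ q.fst
  snd : p.snd ⟶ q.snd
  w : f.map fst ≫ eqToHom q.eq = eqToHom p.eq ≫ g.map snd

instance : Groupoid.{v} (GrpdPullback f g) where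
  Hom p q := Hom p q
  id p := ⟨𝟙 _, 𝟙 _, by simp⟩
  comp a b := ⟨a.fst ≫ b.fst, a.snd ≫ b.snd, by
    rw [f.map_comp, g.map_comp, Category.assoc, b.w, ← Category.assoc, a.w, Category.assoc]⟩
  id_comp a := Hom.ext (Category.id_comp _) (Category.id_comp _)
  comp_id a := Hom.ext (Category.comp_id _) (Category.comp_id _)
  assoc a b c := Hom.ext (Category.assoc _ _ _) (Category.assoc _ _ _)
  inv {p q} a := ⟨Groupoid.inv a.fst, Groupoid.inv a.snd, by
    have h := a.w
    rw [Groupoid.inv_eq_inv, Groupoid.inv_eq_inv, Functor.map_inv, Functor.map_inv,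
      IsIso.inv_comp_eq, ← Category.assoc, h, Category.assoc, IsIso.hom_inv_id,
      Category.comp_id]⟩
  inv_comp a := Hom.ext (Groupoid.inv_comp _) (Groupoid.inv_comp _)
  comp_inv a := Hom.ext (Groupoid.comp_inv _) (Groupoid.comp_inv _)

variable (f g)

/-- The first projection. -/
def π₁ : Grpd.of (GrpdPullback f g) ⟶ X where
  obj p := p.fst
  map a := Hom.fst a
  map_id _ := rfl
  map_comp _ _ := rfl

/-- The second projection. -/
def π₂ : Grpd.of (GrpdPullback f g) ⟶ Y where
  obj p := p.snd
  map a := Hom.snd a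
  map_id _ := rfl
  map_comp _ _ := rfl

lemma condition : π₁ f g ≫ f = π₂ f g ≫ g := by
  refine CategoryTheory.Functor.ext (C := GrpdPullback f g) (D := Z) GrpdPullback.eq
    fun p q a => ?_
  have h := Hom.w a
  change f.map (Hom.fst a) = eqToHom p.eq ≫ g.map (Hom.snd a) ≫ eqToHom q.eq.symm
  rw [← Category.assoc, ← h]
  simp

variable {f g}

/-- The map into the strict pullback given by a commutative square. -/
def lift {T : Grpd.{v, u}} (a : T ⟶ X) (b : T ⟶ Y) (h : a ≫ f = b ≫ g) :
    T ⟶ Grpd.of (GrpdPullback f g) where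
  obj t := ⟨a.obj t, b.obj t, Functor.congr_obj h t⟩
  map {s t} m := ⟨a.map m, b.map m, by
    have := Functor.congr_hom h m
    change f.map (a.map m) = _ ≫ g.map (b.map m) ≫ _ at this
    rw [this]
    simp⟩
  map_id t := Hom.ext (a.map_id t) (b.map_id t)
  map_comp m n := Hom.ext (a.map_comp m n) (b.map_comp m n)

lemma fst_conj {p q p' q' : GrpdPullback f g} (h : p = p') (m : p' ⟶ q') (h' : q' = q) :
    Hom.fst (eqToHom h ≫ m ≫ eqToHom h') = eqToHom (congrArg GrpdPullback.fst h) ≫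
      Hom.fst m ≫ eqToHom (congrArg GrpdPullback.fst h') := by
  subst h h'
  simp

lemma snd_conj {p q p' q' : GrpdPullback f g} (h : p = p') (m : p' ⟶ q') (h' : q' = q) :
    Hom.snd (eqToHom h ≫ m ≫ eqToHom h') = eqToHom (congrArg GrpdPullback.snd h) ≫
      Hom.snd m ≫ eqToHom (congrArg GrpdPullback.snd h') := by
  subst h h'
  simp

lemma hom_ext {T : Grpd.{v, u}} {a b : T ⟶ Grpd.of (GrpdPullback f g)}
    (h₁ : a ≫ π₁ f g = b ≫ π₁ f g) (h₂ : a ≫ π₂ f g = b ≫ π₂ f g) : a = b := by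
  refine CategoryTheory.Functor.ext (C := T) (D := GrpdPullback f g)
    (fun t => GrpdPullback.ext (Functor.congr_obj h₁ t) (Functor.congr_obj h₂ t))
    (fun s t m => Hom.ext ?_ ?_)
  · exact (Functor.congr_hom h₁ m).trans (fst_conj _ (b.map m) _).symm
  · exact (Functor.congr_hom h₂ m).trans (snd_conj _ (b.map m) _).symm

lemma isPullback (f : X ⟶ Z) (g : Y ⟶ Z) : IsPullback (π₁ f g) (π₂ f g) f g :=
  ⟨⟨condition f g⟩, ⟨PullbackCone.IsLimit.mk _ (fun s => lift s.fst s.snd s.condition)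
    (fun _ => rfl) (fun _ => rfl) (fun _ _ h₁ h₂ => hom_ext h₁ h₂)⟩⟩

end GrpdPullback

/-- The (strict, levelwise) pullback of simplicial groupoids. -/
def simplicialPullback {X Y Z : SimplicialObject Grpd.{v, u}} (f : X ⟶ Z) (g : Y ⟶ Z) :
    SimplicialObject Grpd.{v, u} where
  obj n := Grpd.of (GrpdPullback (f.app n) (g.app n))
  map {n m} α := GrpdPullback.lift
    (GrpdPullback.π₁ (f.app n) (g.app n) ≫ X.map α)
    (GrpdPullback.π₂ (f.app n) (g.app n) ≫ Y.map α)
    (by rw [Category.assoc, Category.assoc, f.naturality, g.naturality, ← Category.assoc,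
          ← Category.assoc, GrpdPullback.condition])
  map_id n := GrpdPullback.hom_ext
    (by change _ ≫ X.map (𝟙 n) = _; rw [X.map_id]; rfl)
    (by change _ ≫ Y.map (𝟙 n) = _; rw [Y.map_id]; rfl)
  map_comp α β := GrpdPullback.hom_ext
    (by change _ ≫ X.map (α ≫ β) = _; rw [X.map_comp]; rfl)
    (by change _ ≫ Y.map (α ≫ β) = _; rw [Y.map_comp]; rfl)

/-- The construction `simplicialPullback` is the pullback in simplicial groupoids. -/
lemma isPullback_simplicialPullback {X Y Z : SimplicialObject Grpd.{v, u}}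
    (f : X ⟶ Z) (g : Y ⟶ Z) :
    ∃ (p : simplicialPullback f g ⟶ X) (q : simplicialPullback f g ⟶ Y),
      IsPullback p q f g := by
  let p : simplicialPullback f g ⟶ X :=
    { app := fun n => GrpdPullback.π₁ (f.app n) (g.app n)
      naturality := fun _ _ _ => rfl }
  let q : simplicialPullback f g ⟶ Y :=
    { app := fun n => GrpdPullback.π₂ (f.app n) (g.app n)
      naturality := fun _ _ _ => rfl }
  have hw : p ≫ f = q ≫ g := by
    ext n
    exact GrpdPullback.condition (f.app n) (g.app n)
  refine ⟨p, q, ⟨hw⟩, ⟨PullbackCone.IsLimit.mk hw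
    (fun s =>
      { app := fun n => GrpdPullback.lift (s.fst.app n) (s.snd.app n)
          (NatTrans.congr_app s.condition n)
        naturality := fun m n α => GrpdPullback.hom_ext
          (s.fst.naturality α) (s.snd.naturality α) })
    (fun s => rfl) (fun s => rfl) (fun s m h₁ h₂ => ?_)⟩⟩
  ext n
  exact GrpdPullback.hom_ext (NatTrans.congr_app h₁ n) (NatTrans.congr_app h₂ n)

end StrictPullback

/-- The relative `S_•`-construction of an exact functor `F : A ⥤ B`: the pullback of
`d₀ : P S_•(B) ⟶ S_•(B)` along `S_•(F) : S_•(A) ⟶ S_•(B)`. -/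
def relSdot {A B : Type u} [Category.{v} A] [Preadditive A] [HasFiniteBiproducts A]
    [ExactCategory A] [Category.{v} B] [Preadditive B] [HasFiniteBiproducts B]
    [ExactCategory B] (F : A ⥤ B) [ExactFunctor F] : SimplicialObject Grpd.{v, max u v} :=
  simplicialPullback (initialPathD₀ (sdot B)) (sdotMap F)

section HomotopyLimit

variable {J : Type w} [Category.{w} J]

/-- Objects of the homotopy limit (the pseudo-limit) of a diagram of groupoids `K`: families
of objects `x j` with coherent isomorphisms `K(a)(x i) ⟶ x j` for `a : i ⟶ j`. -/
structure HoLim (K : J ⥤ Grpd.{v, u}) : Type (max w v u) where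
  pt : ∀ j, K.obj j
  iso : ∀ {i j : J} (a : i ⟶ j), (K.map a).obj (pt i) ⟶ pt j
  iso_id : ∀ j, iso (𝟙 j) = eqToHom (Functor.congr_obj (K.map_id j) (pt j))
  iso_comp : ∀ {i j k : J} (a : i ⟶ j) (b : j ⟶ k),
    iso (a ≫ b) = eqToHom (Functor.congr_obj (K.map_comp a b) (pt i)) ≫
      (K.map b).map (iso a) ≫ iso b

namespace HoLim

variable {K : J ⥤ Grpd.{v, u}}

/-- Morphisms of the homotopy limit: families of morphisms compatible with the structure
isomorphisms. -/
@[ext]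
structure Hom (x y : HoLim K) : Type (max w v) where
  app : ∀ j, x.pt j ⟶ y.pt j
  w : ∀ {i j : J} (a : i ⟶ j), x.iso a ≫ app j = (K.map a).map (app i) ≫ y.iso a

instance : Category (HoLim K) where
  Hom x y := Hom x y
  id x := ⟨fun j => 𝟙 _, fun a => by simp⟩
  comp f g := ⟨fun j => f.app j ≫ g.app j, fun a => by
    rw [← Category.assoc, f.w, Category.assoc, g.w, Functor.map_comp, Category.assoc]⟩
  id_comp f := Hom.ext (funext fun j => Category.id_comp _)
  comp_id f := Hom.ext (funext fun j => Category.comp_id _)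
  assoc f g h := Hom.ext (funext fun j => Category.assoc _ _ _)

end HoLim

end HomotopyLimit

section TwoSegal

variable {n : ℕ}

/-- A graph on the vertices `0, …, n` of a convex `(n+1)`-gon without crossing edges. -/
def NonCrossing (T : SimpleGraph (Fin (n + 1))) : Prop :=
  ∀ i k j l : Fin (n + 1), i < k → k < j → j < l → ¬ (T.Adj i j ∧ T.Adj k l)

/-- A triangulation of the convex `(n+1)`-gon with vertices `0, …, n`, given by the set of its
edges (sides and diagonals): a maximal non-crossing graph. -/
def IsTriangulation (T : SimpleGraph (Fin (n + 1))) : Prop :=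
  Maximal NonCrossing T

/-- The category of simplices of the simplicial subset `Δ^T` of `Δ[n]`: maps `[m] ⟶ [n]` such
that any two vertices in the image are equal or joined by an edge of `T`. When `T` is a
triangulation, these are the maps whose image lies in a triangle of `T`. -/
abbrev Simplices (T : SimpleGraph (Fin (n + 1))) : Type :=
  ObjectProperty.FullSubcategory (C := Over (SimplexCategory.mk n))
    (fun α => T.IsClique (Set.range α.hom.toOrderHom))

/-- The diagram `σ ↦ X_m`, for `σ : [m] ⟶ [n]` a simplex of `Δ^T`. -/
def simplexDiagram (X : SimplicialObject Grpd.{v, u}) (T : SimpleGraph (Fin (n + 1))) :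
    (Simplices T)ᵒᵖ ⥤ Grpd.{v, u} :=
  (ObjectProperty.ι _ ⋙ Over.forget (SimplexCategory.mk n)).op ⋙ X

lemma simplexDiagram_obj_map (X : SimplicialObject Grpd.{v, u}) (T : SimpleGraph (Fin (n + 1)))
    {σ τ : (Simplices T)ᵒᵖ} (a : σ ⟶ τ) :
    X.map σ.unop.obj.hom.op ≫ (simplexDiagram X T).map a = X.map τ.unop.obj.hom.op := by
  refine (X.map_comp _ _).symm.trans ?_
  exact congrArg X.map (congrArg Quiver.Hom.op (Over.w a.unop.hom))

lemma eqToHom_eq_comp_map {C D : Type*} [Category C] [Category D] (G : C ⥤ D) {x y : C}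
    {z t : D} (h : z = t) (h₁ : z = G.obj x) (h₂ : x = y) (h₃ : G.obj y = t) :
    eqToHom h = eqToHom h₁ ≫ G.map (eqToHom h₂) ≫ eqToHom h₃ := by
  subst h₂ h₃
  simp

lemma eqToHom_comp_map {C D : Type*} [Category C] [Category D] {G H : C ⥤ D} (h : G = H)
    {x y : C} (f : x ⟶ y) :
    eqToHom (Functor.congr_obj h x) ≫ H.map f =
      G.map f ≫ eqToHom (Functor.congr_obj h y) := by
  subst h
  simp

/-- The `2`-Segal map `X_n ⟶ X_T`, where `X_T` is the homotopy limit of `X` over the simplices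
of `Δ^T`; it sends `x` to the family of its restrictions. -/
def twoSegalMap (X : SimplicialObject Grpd.{v, u}) (T : SimpleGraph (Fin (n + 1))) :
    X.obj (op (SimplexCategory.mk n)) ⥤ HoLim (simplexDiagram X T) where
  obj x :=
    { pt := fun σ => (X.map σ.unop.obj.hom.op).obj x
      iso := fun a => eqToHom (Functor.congr_obj (simplexDiagram_obj_map X T a) x)
      iso_id := fun _ => rfl
      iso_comp := fun a b => eqToHom_eq_comp_map ((simplexDiagram X T).map b) _ _ _ _ }
  map {x y} f :=
    { app := fun σ => (X.map σ.unop.obj.hom.op).map f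
      w := fun a => eqToHom_comp_map (simplexDiagram_obj_map X T a) f }
  map_id x := HoLim.Hom.ext (funext fun σ => (X.map σ.unop.obj.hom.op).map_id x)
  map_comp f g := HoLim.Hom.ext (funext fun σ => (X.map σ.unop.obj.hom.op).map_comp f g)

/-- A simplicial groupoid is `2`-Segal if, for every `n ≥ 2` and every triangulation `T` of the
convex `(n+1)`-gon, the map `X_n ⟶ X_T` is an equivalence of groupoids. -/
def IsTwoSegal (X : SimplicialObject Grpd.{v, u}) : Prop :=
  ∀ (n : ℕ), 2 ≤ n → ∀ T : SimpleGraph (Fin (n + 1)), IsTriangulation T →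
    (twoSegalMap X T).IsEquivalence

end TwoSegal

end RelSdot

/-!
A diagram in `S_n` is determined by its top row `a₀₀ ↣ a₀₁ ↣ ⋯ ↣ a₀ₙ`, being the diagram of the
quotients `a₀ⱼ / a₀ᵢ`. Cutting the ear `{i, i + 1, i + 2}` off a polygon forgets the entry
`a₀,ᵢ₊₁` of the top row and remembers instead the filtration that it induces on the quotient
`a₀,ᵢ₊₂ / a₀ᵢ`. The entry is recovered from this filtration as a pullback, so each such cut exhibits
`S_n` as a homotopy pullback of `S_{n-1}` and `S_2` over `S_1`.

This property of a simplicial groupoid, here called ear locality, passes to the initial path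
object, by cancelling homotopy pullback squares, and to strict pullbacks along levelwise
isofibrations. The functor `d₀` on the initial path object of `S_•` is a levelwise isofibration
because it restricts diagrams along a map which is injective on objects.

Every triangulation of a polygon with more than three vertices has an ear `{i, i + 1, i + 2}` cut
off by one of its diagonals. The simplices of the triangulation are those of the remaining polygon
together with those of the ear, glued along the common edge, so that the homotopy limit over them
embeds fully faithfully into the homotopy pullback that computes the value of an ear local
simplicial groupoid on the polygon. The 2-Segal property follows by induction, starting with the
triangle.
-/

namespace RelSdot

/-! ### Exact categories -/

section ExactPairs

open scoped ZeroObject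

variable {C : Type u} [Category.{v} C] [Preadditive C] [HasFiniteBiproducts C] [ExactCategory C]

/-- `i` and `p` are the two maps of an exact sequence: the family `ExactCategory.exactSeq`, with
the vanishing of `i ≫ p` as part of the assertion. -/
def IsExactPair {X Y Z : C} (i : X ⟶ Y) (p : Y ⟶ Z) : Prop :=
  ∃ w : i ≫ p = 0, ExactCategory.exactSeq (ShortComplex.mk i p w)

lemma adMono_iff {X Y : C} {i : X ⟶ Y} : adMono C i ↔ ∃ (Z : C) (p : Y ⟶ Z), IsExactPair i p :=
  Iff.rfl

lemma adEpi_iff {Y Z : C} {p : Y ⟶ Z} : adEpi C p ↔ ∃ (X : C) (i : X ⟶ Y), IsExactPair i p :=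
  Iff.rfl

namespace IsExactPair

variable {X Y Z : C} {i : X ⟶ Y} {p : Y ⟶ Z}

lemma zero (h : IsExactPair i p) : i ≫ p = 0 := h.1

lemma adMono (h : IsExactPair i p) : adMono C i := adMono_iff.2 ⟨Z, p, h⟩

lemma adEpi (h : IsExactPair i p) : adEpi C p := adEpi_iff.2 ⟨X, i, h⟩

lemma mono (h : IsExactPair i p) : Mono i := by
  obtain ⟨k⟩ := ExactCategory.isKernel _ h.2
  exact ⟨fun f g h => Fork.IsLimit.hom_ext k (by simpa using h)⟩

lemma epi (h : IsExactPair i p) : Epi p := by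
  obtain ⟨k⟩ := ExactCategory.isCokernel _ h.2
  exact ⟨fun f g h => Cofork.IsColimit.hom_ext k (by simpa using h)⟩

lemma exists_lift (h : IsExactPair i p) {T : C} (t : T ⟶ Y) (ht : t ≫ p = 0) :
    ∃ s : T ⟶ X, s ≫ i = t := by
  obtain ⟨k⟩ := ExactCategory.isKernel _ h.2
  exact ⟨_, (KernelFork.IsLimit.lift' k t ht).2⟩

lemma exists_desc (h : IsExactPair i p) {T : C} (t : Y ⟶ T) (ht : i ≫ t = 0) :
    ∃ s : Z ⟶ T, p ≫ s = t := by
  obtain ⟨k⟩ := ExactCategory.isCokernel _ h.2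
  exact ⟨_, (CokernelCofork.IsColimit.desc' k t ht).2⟩

lemma of_iso (h : IsExactPair i p) {X' Y' Z' : C} (a : X ≅ X') (b : Y ≅ Y') (c : Z ≅ Z')
    {i' : X' ⟶ Y'} {p' : Y' ⟶ Z'} (h₁ : a.hom ≫ i' = i ≫ b.hom) (h₂ : b.hom ≫ p' = p ≫ c.hom) :
    IsExactPair i' p' := by
  have w : i' ≫ p' = 0 := by
    rw [← cancel_epi a.hom, reassoc_of% h₁, h₂, reassoc_of% h.zero, zero_comp, comp_zero]
  exact ⟨w, ExactCategory.closed_iso _ _ ⟨ShortComplex.isoMk a b c h₁ h₂⟩ h.2⟩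

end IsExactPair

lemma mono_of_adMono {X Y : C} {i : X ⟶ Y} (h : adMono C i) : Mono i := by
  obtain ⟨Z, p, h⟩ := adMono_iff.1 h
  exact h.mono

lemma adMono_of_iso {X Y X' Y' : C} {i : X ⟶ Y} (h : adMono C i) (a : X ≅ X') (b : Y ≅ Y')
    {i' : X' ⟶ Y'} (h₁ : a.hom ≫ i' = i ≫ b.hom) : adMono C i' := by
  obtain ⟨Z, p, h⟩ := adMono_iff.1 h
  exact (h.of_iso a b (Iso.refl Z) (p' := b.inv ≫ p) h₁ (by simp)).adMono

lemma adEpi_of_iso {X Y X' Y' : C} {p : X ⟶ Y} (h : adEpi C p) (a : X ≅ X') (b : Y ≅ Y')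
    {p' : X' ⟶ Y'} (h₁ : a.hom ≫ p' = p ≫ b.hom) : adEpi C p' := by
  obtain ⟨K, i, h⟩ := adEpi_iff.1 h
  exact (h.of_iso (Iso.refl K) a b (i' := i ≫ a.hom) (by simp) h₁).adEpi

lemma adEpi_of_isPullback {X Y Z W : C} {i : X ⟶ Y} {p : X ⟶ Z} {q : Y ⟶ W} {j : Z ⟶ W}
    (sq : IsPullback i p q j) (hq : adEpi C q) : adEpi C p := by
  obtain ⟨T, f', p', sq', hp'⟩ := ExactCategory.pullback_epi j q hq
  exact adEpi_of_iso hp' (sq'.isoIsPullback _ _ sq) (Iso.refl Z) (by simp)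

lemma adMono_of_isPushout {X Y Z W : C} {i : X ⟶ Y} {p : X ⟶ Z} {q : Y ⟶ W} {j : Z ⟶ W}
    (sq : IsPushout i p q j) (hi : adMono C i) : adMono C j := by
  obtain ⟨T, f', p', sq', hp'⟩ := ExactCategory.pushout_mono p i hi
  exact adMono_of_iso hp' (Iso.refl Z) (sq'.isoIsPushout _ _ sq) (by simp)

lemma adMono_of_isIso {X Y : C} (i : X ⟶ Y) [IsIso i] : adMono C i := by
  have := hasZeroObject_of_hasFiniteBiproducts C
  obtain ⟨K, k, h⟩ := adEpi_iff.1 (ExactCategory.id_zero (0 : C) (isZero_zero C))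
  have := h.mono
  have : IsIso k :=
    isIso_of_source_target_iso_zero k (IsZero.of_mono k (isZero_zero C)).isoZero (Iso.refl 0)
  obtain ⟨T, g', j, sq, hj⟩ := ExactCategory.pushout_mono (0 : K ⟶ X) k h.adMono
  have : IsIso j := sq.isIso_inr_of_isIso
  exact adMono_of_iso hj (Iso.refl X) ((asIso j).symm ≪≫ asIso i) (by simp)

namespace IsExactPair

lemma of_exists_lift {X Y Z : C} {i : X ⟶ Y} {p : Y ⟶ Z} [Mono i] (hp : RelSdot.adEpi C p)
    (w : i ≫ p = 0) (hi : ∀ {T : C} (t : T ⟶ Y), t ≫ p = 0 → ∃ s : T ⟶ X, s ≫ i = t) :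
    IsExactPair i p := by
  obtain ⟨K, k, h⟩ := adEpi_iff.1 hp
  have := h.mono
  obtain ⟨a, ha⟩ := hi k h.zero
  obtain ⟨b, hb⟩ := h.exists_lift i w
  exact h.of_iso ⟨a, b, by simp [← cancel_mono k, ha, hb], by simp [← cancel_mono i, ha, hb]⟩
    (Iso.refl Y) (Iso.refl Z) (by simpa using ha) (by simp)

lemma of_exists_desc {X Y Z : C} {i : X ⟶ Y} {p : Y ⟶ Z} [Epi p] (hi : RelSdot.adMono C i)
    (w : i ≫ p = 0) (hp : ∀ {T : C} (t : Y ⟶ T), i ≫ t = 0 → ∃ s : Z ⟶ T, p ≫ s = t) :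
    IsExactPair i p := by
  obtain ⟨Q, q, h⟩ := adMono_iff.1 hi
  have := h.epi
  obtain ⟨a, ha⟩ := hp q h.zero
  obtain ⟨b, hb⟩ := h.exists_desc p w
  exact h.of_iso (Iso.refl X) (Iso.refl Y)
    ⟨b, a, by simp [← cancel_epi q, reassoc_of% hb, ha],
      by simp [← cancel_epi p, reassoc_of% ha, hb]⟩ (by simp) (by simpa using hb.symm)

lemma isPullback {X Y Z W Q : C} {i : X ⟶ Y} {p : X ⟶ Z} {q : Y ⟶ W} {j : Z ⟶ W} {a : Y ⟶ Q}
    {b : W ⟶ Q} (h : IsExactPair i a) (h' : IsExactPair j b) (sq : i ≫ q = p ≫ j)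
    (hab : q ≫ b = a) : IsPullback i p q j := by
  obtain ⟨k⟩ := ExactCategory.isKernel _ h.2
  obtain ⟨k'⟩ := ExactCategory.isKernel _ h'.2
  exact isPullback_of_rows sq hab _ _ k k'

lemma isPushout {K X Y Z W : C} {i : X ⟶ Y} {p : X ⟶ Z} {q : Y ⟶ W} {j : Z ⟶ W} {a : K ⟶ X}
    {b : K ⟶ Y} (h : IsExactPair a p) (h' : IsExactPair b q) (sq : i ≫ q = p ≫ j)
    (hab : a ≫ i = b) : IsPushout i p q j := by
  obtain ⟨k⟩ := ExactCategory.isCokernel _ h.2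
  obtain ⟨k'⟩ := ExactCategory.isCokernel _ h'.2
  exact isPushout_of_cols sq hab _ _ k k'

lemma exists_of_isPushout {X Y Z W : C} {i : X ⟶ Y} {p : X ⟶ Z} {q : Y ⟶ W} {j : Z ⟶ W}
    (sq : IsPushout i p q j) (hi : RelSdot.adMono C i) :
    ∃ (Q : C) (b : W ⟶ Q), IsExactPair i (q ≫ b) ∧ IsExactPair j b := by
  obtain ⟨Q, b, w₁, w₂, h₁, h₂⟩ := exists_exactSeq_right hi (adMono_of_isPushout sq hi) sq
  exact ⟨Q, b, ⟨w₁, h₁⟩, ⟨w₂, h₂⟩⟩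

end IsExactPair

end ExactPairs

section CompositionOfMonos

variable {C : Type u} [Category.{v} C] [Preadditive C]

lemma isPullback_biprod_snd_map [HasBinaryBiproducts C] (Z : C) {Y Q : C} (p : Y ⟶ Q) :
    IsPullback (biprod.snd : Z ⊞ Y ⟶ Y) (biprod.map (𝟙 Z) p) p biprod.snd := by
  refine ⟨⟨by simp⟩, ⟨PullbackCone.IsLimit.mk _
    (fun s => biprod.lift (s.snd ≫ biprod.fst) s.fst) (fun s => by simp) (fun s => ?_)
    fun s m hm hm' => ?_⟩⟩
  · ext <;> simp [s.condition]
  · ext <;> simp [← hm, ← hm']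

lemma isPushout_biprod_map_fst [HasBinaryBiproducts C] {X Z : C} (f : X ⟶ Z) (Y : C) :
    IsPushout (biprod.map f (𝟙 Y)) biprod.fst biprod.fst f := by
  refine ⟨⟨by simp⟩, ⟨PushoutCocone.IsColimit.mk _ (fun s => biprod.inl ≫ s.inl) (fun s => ?_)
    (fun s => ?_) fun s m hm _ => ?_⟩⟩
  · have hs : 0 = biprod.inr ≫ s.inl := by simpa using (biprod.inr ≫= s.condition).symm
    ext <;> simp [← hs]
  · simpa using biprod.inl ≫= s.condition
  · simp [← hm]

attribute [local instance] hasBinaryBiproducts_of_finite_biproducts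

variable [HasFiniteBiproducts C] [ExactCategory C]

lemma IsExactPair.isPullback_biprod_desc {Y Z W Q : C} {j : Y ⟶ W} {b : W ⟶ Q}
    (h : IsExactPair j b) (p : Z ⟶ W) :
    IsPullback (biprod.fst : Z ⊞ Y ⟶ Z) (biprod.desc p j) (p ≫ b) b := by
  have := h.mono
  have hl : ∀ s : PullbackCone (p ≫ b) b, ∃ l, l ≫ j = s.snd - s.fst ≫ p := fun s =>
    h.exists_lift _ (by simpa [sub_eq_zero] using s.condition.symm)
  choose l hl using hl
  refine ⟨⟨by ext <;> simp [h.zero]⟩, ⟨PullbackCone.IsLimit.mk _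
    (fun s => biprod.lift s.fst (l s)) (fun s => by simp) (fun s => by simp [hl])
    fun s m hm hm' => ?_⟩⟩
  ext
  · simpa using hm
  · simp [← cancel_mono j, hl, ← hm, ← hm', biprod.desc_eq]

-- Keller's argument: up to the elementary automorphism of `Z ⊞ Y` given by `g`, this is a composite
-- of two admissible epimorphisms obtained by pullback.
lemma adEpi_biprod_fst_comp {Y Z P Q : C} {g : Y ⟶ Z} {p : Y ⟶ Q} {p' : Z ⟶ P} {j : Q ⟶ P}
    (sq : IsPushout g p p' j) (hg : adMono C g) (hp : adEpi C p) :
    adEpi C ((biprod.fst : Z ⊞ Y ⟶ Z) ≫ p') := by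
  obtain ⟨R, b, hgb, hjb⟩ := IsExactPair.exists_of_isPushout sq hg
  have hdesc : adEpi C (biprod.desc p' j) :=
    adEpi_of_isPullback (hjb.isPullback_biprod_desc p') hgb.adEpi
  have hmap : adEpi C (biprod.map (𝟙 Z) p) :=
    adEpi_of_isPullback (isPullback_biprod_snd_map Z p) hp
  refine adEpi_of_iso (ExactCategory.comp_epi _ _ hmap hdesc)
    (Biprod.unipotentLower g) (Iso.refl P) ?_
  ext <;> simp [Biprod.ofComponents, sq.w]

lemma adMono_comp {X Y Z : C} {f : X ⟶ Y} {g : Y ⟶ Z} (hf : adMono C f) (hg : adMono C g) :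
    adMono C (f ≫ g) := by
  obtain ⟨Q, p, hfp⟩ := adMono_iff.1 hf
  obtain ⟨P, p', j, sq, -⟩ := ExactCategory.pushout_mono p g hg
  obtain ⟨R, b, hgb, hjb⟩ := IsExactPair.exists_of_isPushout sq hg
  have := hfp.mono
  have := hgb.mono
  have hexact : IsExactPair (biprod.map (f ≫ g) (𝟙 Y)) ((biprod.fst : Z ⊞ Y ⟶ Z) ≫ p') := by
    refine .of_exists_lift (adEpi_biprod_fst_comp sq hg hfp.adEpi)
      (by ext <;> simp [sq.w, reassoc_of% hfp.zero]) fun t ht => ?_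
    obtain ⟨y, hy, hy'⟩ :=
      (hgb.isPullback hjb sq.w rfl).exists_lift (t ≫ biprod.fst) 0 (by simpa using ht)
    obtain ⟨x, rfl⟩ := hfp.exists_lift y hy'
    exact ⟨biprod.lift x (t ≫ biprod.snd), by ext <;> simp [← hy]⟩
  exact adMono_of_isPushout (isPushout_biprod_map_fst (f ≫ g) Y) hexact.adMono

end CompositionOfMonos

/-! ### Diagrams of quotients -/

section Quotients

variable {C : Type u} [Category.{v} C] [Preadditive C] [HasFiniteBiproducts C] [ExactCategory C]

lemma adMono_of_isPullback {X Y Z W : C} {i : X ⟶ Y} {p : X ⟶ Z} {q : Y ⟶ W} {j : Z ⟶ W}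
    (sq : IsPullback i p q j) (hq : adEpi C q) (hj : adMono C j) : adMono C i := by
  obtain ⟨R, r, h⟩ := adMono_iff.1 hj
  have := h.mono
  have : Mono i := sq.mono_fst_of_mono
  refine (IsExactPair.of_exists_lift (ExactCategory.comp_epi _ _ hq h.adEpi)
    (by rw [reassoc_of% sq.w, h.zero, comp_zero]) fun t ht => ?_).adMono
  obtain ⟨s, hs⟩ := h.exists_lift (t ≫ q) (by simpa using ht)
  exact ⟨sq.lift t s hs.symm, sq.lift_fst _ _ _⟩

namespace IsExactPair

variable {X Y Z : C} {i : X ⟶ Y} {p : Y ⟶ Z}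

lemma exists_map (h : IsExactPair i p) {X' Y' Z' : C} {i' : X' ⟶ Y'} {p' : Y' ⟶ Z'}
    (h' : IsExactPair i' p') (a : X ⟶ X') (b : Y ⟶ Y') (w : i ≫ b = a ≫ i') :
    ∃ c : Z ⟶ Z', p ≫ c = b ≫ p' :=
  h.exists_desc _ (by rw [reassoc_of% w, h'.zero, comp_zero])

lemma exists_iso (h : IsExactPair i p) {X' Y' Z' : C} {i' : X' ⟶ Y'} {p' : Y' ⟶ Z'}
    (h' : IsExactPair i' p') (a : X ≅ X') (b : Y ≅ Y') (w : i ≫ b.hom = a.hom ≫ i') :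
    ∃ c : Z ≅ Z', p ≫ c.hom = b.hom ≫ p' := by
  have := h.epi
  have := h'.epi
  obtain ⟨c, hc⟩ := h.exists_map h' a.hom b.hom w
  obtain ⟨d, hd⟩ := h'.exists_map h a.inv b.inv (by simp [Iso.comp_inv_eq, w])
  exact ⟨⟨c, d, by simp [← cancel_epi p, reassoc_of% hc, hd],
    by simp [← cancel_epi p', reassoc_of% hd, hc]⟩, hc⟩

lemma isZero_of_isIso (h : IsExactPair i p) [IsIso i] : IsZero Z := by
  have := h.epi
  have hp : p = 0 := by rw [← cancel_epi i, h.zero, comp_zero]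
  rw [IsZero.iff_id_eq_zero, ← cancel_epi p, hp, zero_comp, zero_comp]

lemma of_isPullback {X' Z' : C} {q : X' ⟶ Z'} {f : X' ⟶ Y} {g : Z' ⟶ Z}
    (h : IsExactPair i p) (sq : IsPullback f q p g) {l : X ⟶ X'} (hl : l ≫ f = i)
    (hl' : l ≫ q = 0) : IsExactPair l q := by
  have := h.mono
  have : Mono (l ≫ f) := hl ▸ h.mono
  have : Mono l := mono_of_mono l f
  refine .of_exists_lift (adEpi_of_isPullback sq h.adEpi) hl' fun t ht => ?_
  obtain ⟨s, hs⟩ := h.exists_lift (t ≫ f) (by rw [Category.assoc, sq.w, reassoc_of% ht, zero_comp])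
  exact ⟨s, sq.hom_ext (by rw [Category.assoc, hl, hs])
    (by rw [Category.assoc, hl', ht, comp_zero])⟩

lemma of_isPushout_of_isZero {Z' W : C} {z : X ⟶ Z'} {q : Y ⟶ W} {j : Z' ⟶ W}
    (sq : IsPushout i z q j) (hi : RelSdot.adMono C i) (hZ : IsZero Z') : IsExactPair i q := by
  have : Epi q := ⟨fun f g hfg => sq.hom_ext hfg (hZ.eq_of_src _ _)⟩
  refine .of_exists_desc hi (by rw [sq.w, hZ.eq_zero_of_src j, comp_zero]) fun t ht => ?_
  exact ⟨sq.desc t 0 (by rw [ht, comp_zero]), sq.inl_desc _ _ _⟩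

lemma third_isomorphism (h : IsExactPair i p) {W Q R : C} {j : Y ⟶ W} {q : W ⟶ Q} {r : W ⟶ R}
    (h' : IsExactPair (i ≫ j) q) (hj : IsExactPair j r) {t : Z ⟶ Q} (ht : p ≫ t = j ≫ q)
    {s : Q ⟶ R} (hs : q ≫ s = r) : IsExactPair t s := by
  obtain ⟨R', b, hb, hb'⟩ := exists_of_isPushout (h.isPushout h' ht.symm rfl) hj.adMono
  obtain ⟨e, he⟩ := hb.exists_iso hj (Iso.refl _) (Iso.refl _) (by simp)
  have := h'.epi
  refine hb'.of_iso (Iso.refl _) (Iso.refl _) e (by simp) ?_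
  simpa [← cancel_epi q, hs] using he.symm

end IsExactPair

end Quotients

section QuotientDiagrams

namespace Ar

/-- The projection `(i, j) ↦ j`. -/
def snd (n : SimplexCategory) : Ar n ⥤ Fin (n.len + 1) :=
  Monotone.functor (f := fun p : Ar n => p.1.2) fun _ _ h => h.2

/-- The top row `k ↦ (0, k)`. -/
def row (n : SimplexCategory) : Fin (n.len + 1) ⥤ Ar n :=
  Monotone.functor (f := fun k => mk 0 k (Fin.zero_le k)) fun _ _ h => ⟨le_rfl, h⟩

/-- The last object `(0, n)` of the top row. -/
abbrev top (n : SimplexCategory) : Ar n := (row n).obj (Fin.last _)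

/-- The vertical morphisms `(0, j) ⟶ (i, j)`, as a natural transformation. -/
def rowTo (n : SimplexCategory) : snd n ⋙ row n ⟶ 𝟭 (Ar n) where
  app p := homOfLE ⟨Fin.zero_le p.1.1, le_rfl⟩

end Ar

/-- The functor between the posets `[m]` and `[n]` given by a monotone map. -/
abbrev vertexMap {m n : SimplexCategory} (α : m ⟶ n) : Fin (m.len + 1) ⥤ Fin (n.len + 1) :=
  α.toOrderHom.monotone.functor

variable {C : Type u} [Category.{v} C] {n : SimplexCategory}

section Naturality

variable {M : Fin (n.len + 1) ⥤ C} {D : Ar n ⥤ C} (π : Ar.snd n ⋙ M ⟶ D)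

lemma app_comp_map_hor (i j l : Fin (n.len + 1)) (hij : i ≤ j) (hjl : j ≤ l) :
    π.app (Ar.mk i j hij) ≫ D.map (Ar.hor i j l hij hjl) =
      M.map (homOfLE hjl) ≫ π.app (Ar.mk i l (hij.trans hjl)) :=
  (π.naturality (Ar.hor i j l hij hjl)).symm

lemma app_comp_map_ver (i k j : Fin (n.len + 1)) (hik : i ≤ k) (hkj : k ≤ j) :
    π.app (Ar.mk i j (hik.trans hkj)) ≫ D.map (Ar.ver i k j hik hkj) = π.app (Ar.mk k j hkj) :=
  (π.naturality (Ar.ver i k j hik hkj)).symm.trans ((congrArg (· ≫ _) (M.map_id _)).trans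
    (Category.id_comp _))

end Naturality

variable [Preadditive C] [HasFiniteBiproducts C] [ExactCategory C]

/-- `π` exhibits `D` as the diagram of quotients `M j / M i` of a chain `M 0 ⟶ ⋯ ⟶ M n`, its
components being the quotient maps `M j ⟶ M j / M i`. -/
def IsQuotientDiagram {M : Fin (n.len + 1) ⥤ C} {D : Ar n ⥤ C} (π : Ar.snd n ⋙ M ⟶ D) : Prop :=
  ∀ p : Ar n, IsExactPair (M.map (homOfLE p.2)) (π.app p)

lemma exists_isQuotientDiagram (M : Fin (n.len + 1) ⥤ C)
    (hM : ∀ {k l} (a : k ⟶ l), adMono C (M.map a)) :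
    ∃ (D : Ar n ⥤ C) (π : Ar.snd n ⋙ M ⟶ D), IsQuotientDiagram π := by
  have hquot (p : Ar n) : ∃ (Q : C) (π : (Ar.snd n ⋙ M).obj p ⟶ Q),
      IsExactPair (M.map (homOfLE p.2)) π := adMono_iff.1 (hM _)
  choose Q π hπ using hquot
  have hepi : ∀ p, Epi (π p) := fun p => (hπ p).epi
  have hmap {p q : Ar n} (a : p ⟶ q) : ∃ g : Q p ⟶ Q q,
      π p ≫ g = (Ar.snd n ⋙ M).map a ≫ π q :=
    (hπ p).exists_map (hπ q) (M.map (homOfLE (leOfHom a).1)) _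
      ((M.map_comp _ _).symm.trans (M.map_comp (homOfLE (leOfHom a).1) (homOfLE q.2)))
  choose g hg using @hmap
  let D : Ar n ⥤ C :=
    { obj := Q
      map := g
      map_id := fun p => by
        rw [← cancel_epi (π p), hg, CategoryTheory.Functor.map_id, Category.id_comp,
          Category.comp_id]
      map_comp := fun {p q r} a b => by
        rw [← cancel_epi (π p), hg, Functor.map_comp, Category.assoc, ← hg b, ← Category.assoc,
          ← hg a, Category.assoc] }
  exact ⟨D, { app := π, naturality := fun p q a => (hg a).symm }, hπ⟩

namespace IsQuotientDiagram

variable {M M' : Fin (n.len + 1) ⥤ C} {D D' : Ar n ⥤ C} {π : Ar.snd n ⋙ M ⟶ D}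
  {π' : Ar.snd n ⋙ M' ⟶ D'}

lemma epi_app (h : IsQuotientDiagram π) (p : Ar n) : Epi (π.app p) := (h p).epi

lemma epi (h : IsQuotientDiagram π) : Epi π :=
  have := h.epi_app
  NatTrans.epi_of_epi_app π

lemma comp_map (h : IsQuotientDiagram π) {m : SimplexCategory} (α : m ⟶ n) :
    IsQuotientDiagram (M := vertexMap α ⋙ M) (D := Ar.map α ⋙ D)
      (Functor.whiskerLeft (Ar.map α) π) :=
  fun p => h ((Ar.map α).obj p)

lemma exists_hom (h : IsQuotientDiagram π) (h' : IsQuotientDiagram π') (f : M ⟶ M') :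
    ∃ g : D ⟶ D', π ≫ g = Functor.whiskerLeft (Ar.snd n) f ≫ π' := by
  have := h.epi_app
  have hmap (p : Ar n) : ∃ g : D.obj p ⟶ D'.obj p,
      π.app p ≫ g = f.app ((Ar.snd n).obj p) ≫ π'.app p :=
    (h p).exists_map (h' p) (f.app _) (f.app _) (f.naturality _)
  choose g hg using hmap
  refine ⟨{ app := g, naturality := fun p q a => ?_ }, by ext p; exact hg p⟩
  rw [← cancel_epi (π.app p), ← NatTrans.naturality_assoc, hg, reassoc_of% hg,
    ← π'.naturality]
  exact (f.naturality_assoc _ _)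

lemma exists_iso (h : IsQuotientDiagram π) (h' : IsQuotientDiagram π') (f : M ≅ M') :
    ∃ g : D ≅ D', π ≫ g.hom = Functor.whiskerLeft (Ar.snd n) f.hom ≫ π' := by
  have := h.epi
  have := h'.epi
  obtain ⟨a, ha⟩ := h.exists_hom h' f.hom
  obtain ⟨b, hb⟩ := h'.exists_hom h f.inv
  refine ⟨⟨a, b, ?_, ?_⟩, ha⟩
  · simp [← cancel_epi π, reassoc_of% ha, hb, ← Functor.whiskerLeft_comp_assoc]
  · simp [← cancel_epi π', reassoc_of% hb, ha, ← Functor.whiskerLeft_comp_assoc]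

lemma isExactPair_comp (h : IsQuotientDiagram π) {i j l : Fin (n.len + 1)} (hij : i ≤ j)
    (hjl : j ≤ l) : IsExactPair (M.map (homOfLE hij) ≫ M.map (homOfLE hjl))
      (π.app (Ar.mk i l (hij.trans hjl))) := by
  rw [← M.map_comp]
  exact h (Ar.mk i l (hij.trans hjl))

lemma isExactPair_hor_ver (h : IsQuotientDiagram π) {i j l : Fin (n.len + 1)} (hij : i ≤ j)
    (hjl : j ≤ l) :
    IsExactPair (D.map (Ar.hor i j l hij hjl)) (D.map (Ar.ver i j l hij hjl)) :=
  (h (Ar.mk i j hij)).third_isomorphism (h.isExactPair_comp hij hjl) (h (Ar.mk j l hjl))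
    (app_comp_map_hor π i j l hij hjl) (app_comp_map_ver π i j l hij hjl)

lemma isPushout_hor (h : IsQuotientDiagram π) {i j l : Fin (n.len + 1)} (hij : i ≤ j)
    (hjl : j ≤ l) :
    IsPushout (M.map (homOfLE hjl)) (π.app (Ar.mk i j hij)) (π.app (Ar.mk i l (hij.trans hjl)))
      (D.map (Ar.hor i j l hij hjl)) :=
  (h (Ar.mk i j hij)).isPushout (h.isExactPair_comp hij hjl)
    (app_comp_map_hor π i j l hij hjl).symm rfl

lemma isSdot (h : IsQuotientDiagram π) : IsSdot C D where
  zero i := by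
    have hi := h (Ar.mk i i le_rfl)
    have : IsIso (M.map (homOfLE (le_refl i))) := inferInstanceAs (IsIso (M.map (𝟙 i)))
    exact hi.isZero_of_isIso
  mono i j l hij hjl := (h.isExactPair_hor_ver hij hjl).adMono
  epi i k j hik hkj := (h.isExactPair_hor_ver hik hkj).adEpi
  square i k j l hik hkj hjl := by
    have comm : D.map (Ar.hor i j l (hik.trans hkj) hjl) ≫
        D.map (Ar.ver i k l hik (hkj.trans hjl)) =
          D.map (Ar.ver i k j hik hkj) ≫ D.map (Ar.hor k j l hkj hjl) := by
      rw [← D.map_comp, ← D.map_comp]; rfl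
    have hpo := h.isPushout_hor hkj hjl
    rw [← app_comp_map_ver π i k j hik hkj, ← app_comp_map_ver π i k l hik (hkj.trans hjl)] at hpo
    refine BicartesianSq.of_isPullback_isPushout
      ((h.isExactPair_hor_ver (hik.trans hkj) hjl).isPullback (h.isExactPair_hor_ver hkj hjl) comm
        (D.map_comp _ (Ar.ver k j l hkj hjl)).symm)
      (hpo.of_top comm (h.isPushout_hor (hik.trans hkj) hjl))

end IsQuotientDiagram

end QuotientDiagrams

namespace IsSdot

variable {C : Type u} [Category.{v} C] [Preadditive C] [HasFiniteBiproducts C] [ExactCategory C]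
  {n : SimplexCategory} {D D' : Ar n ⥤ C}

lemma of_iso (h : IsSdot C D) (e : D ≅ D') : IsSdot C D' where
  zero i := (h.zero i).of_iso (e.app _).symm
  mono i j l hij hjl := adMono_of_iso (h.mono i j l hij hjl) (e.app _) (e.app _)
    (e.hom.naturality _).symm
  epi i k j hik hkj := adEpi_of_iso (h.epi i k j hik hkj) (e.app _) (e.app _)
    (e.hom.naturality _).symm
  square i k j l hik hkj hjl := by
    have sq := h.square i k j l hik hkj hjl
    exact BicartesianSq.of_isPullback_isPushout
      (sq.toIsPullback.of_iso (e.app _) (e.app _) (e.app _) (e.app _) (e.hom.naturality _)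
        (e.hom.naturality _) (e.hom.naturality _) (e.hom.naturality _))
      (sq.toIsPushout.of_iso (e.app _) (e.app _) (e.app _) (e.app _) (e.hom.naturality _)
        (e.hom.naturality _) (e.hom.naturality _) (e.hom.naturality _))

lemma bicartesianSq_map (h : IsSdot C D) {p q r s : Ar n} (a : p ⟶ q) (b : p ⟶ r) (c : q ⟶ s)
    (d : r ⟶ s) (h₁ : p.1.1 = q.1.1) (h₂ : p.1.2 = r.1.2) (h₃ : q.1.2 = s.1.2)
    (h₄ : r.1.1 = s.1.1) : BicartesianSq (D.map a) (D.map b) (D.map c) (D.map d) := by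
  obtain ⟨⟨i, j⟩, hij⟩ := p
  obtain ⟨⟨i', l⟩, hil⟩ := q
  obtain ⟨⟨k, j'⟩, hkj⟩ := r
  obtain ⟨⟨k', l'⟩, hkl⟩ := s
  obtain rfl : i = i' := h₁
  obtain rfl : j = j' := h₂
  obtain rfl : l = l' := h₃
  obtain rfl : k = k' := h₄
  exact h.square i k j l (leOfHom b).1 hkj (leOfHom a).2

lemma isExactPair (h : IsSdot C D) {i j l : Fin (n.len + 1)} (hij : i ≤ j) (hjl : j ≤ l) :
    IsExactPair (D.map (Ar.hor i j l hij hjl)) (D.map (Ar.ver i j l hij hjl)) :=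
  .of_isPushout_of_isZero (h.square i j j l hij le_rfl hjl).toIsPushout (h.mono _ _ _ _ _)
    (h.zero j)

lemma isQuotientDiagram (h : IsSdot C D) :
    IsQuotientDiagram (M := Ar.row n ⋙ D) (Functor.whiskerRight (Ar.rowTo n) D) :=
  fun p => h.isExactPair (Fin.zero_le _) p.2

lemma adMono_row_map (h : IsSdot C D) {k l : Fin (n.len + 1)} (a : k ⟶ l) :
    adMono C ((Ar.row n ⋙ D).map a) :=
  h.mono 0 k l (Fin.zero_le k) (leOfHom a)

lemma hom_ext_row (h : IsSdot C D) {f g : D ⟶ D'}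
    (e : ∀ k, f.app ((Ar.row n).obj k) = g.app ((Ar.row n).obj k)) : f = g := by
  ext p
  have := h.isQuotientDiagram.epi_app p
  rw [← cancel_epi ((Functor.whiskerRight (Ar.rowTo n) D).app p)]
  simp [e]

/-- The morphisms of the top row into its last entry. -/
abbrev toTop (D : Ar n ⥤ C) (k : Fin (n.len + 1)) : D.obj ((Ar.row n).obj k) ⟶ D.obj (Ar.top n) :=
  (Ar.row n ⋙ D).map (homOfLE (Fin.le_last k))

lemma mono_toTop (h : IsSdot C D) (k : Fin (n.len + 1)) : Mono (toTop D k) :=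
  mono_of_adMono (h.adMono_row_map _)

lemma hom_ext_top (h : IsSdot C D) (h' : IsSdot C D') {f g : D ⟶ D'}
    (e : f.app (Ar.top n) = g.app (Ar.top n)) : f = g := by
  refine h.hom_ext_row fun k => ?_
  have := h'.mono_toTop k
  rw [← cancel_mono (toTop D' k)]
  simp [toTop, e, ← NatTrans.naturality]

lemma exists_hom_of_top (h : IsSdot C D) (h' : IsSdot C D')
    (t : D.obj (Ar.top n) ⟶ D'.obj (Ar.top n))
    (ht : ∀ k, ∃ f : D.obj ((Ar.row n).obj k) ⟶ D'.obj ((Ar.row n).obj k),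
      f ≫ toTop D' k = toTop D k ≫ t) :
    ∃ g : D ⟶ D', g.app (Ar.top n) = t := by
  choose f hf using ht
  let F : Ar.row n ⋙ D ⟶ Ar.row n ⋙ D' :=
    { app := f
      naturality := fun k l a => by
        have := h'.mono_toTop l
        rw [← cancel_mono (toTop D' l), Category.assoc, Category.assoc, hf,
          ← Functor.map_comp, ← Functor.map_comp_assoc]
        exact (hf k).symm }
  obtain ⟨g, hg⟩ := h.isQuotientDiagram.exists_hom h'.isQuotientDiagram F
  refine ⟨g, ?_⟩
  have hg_top := NatTrans.congr_app hg (Ar.top n)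
  have hf_top := hf (Fin.last _)
  change D.map (𝟙 (Ar.top n)) ≫ g.app (Ar.top n) = f (Fin.last _) ≫ D'.map (𝟙 (Ar.top n)) at hg_top
  change f (Fin.last _) ≫ D'.map (𝟙 (Ar.top n)) = D.map (𝟙 (Ar.top n)) ≫ t at hf_top
  simpa using hg_top.trans hf_top

lemma exists_iso_of_top (h : IsSdot C D) (h' : IsSdot C D')
    (t : D.obj (Ar.top n) ≅ D'.obj (Ar.top n))
    (ht : ∀ k, ∃ f : D.obj ((Ar.row n).obj k) ≅ D'.obj ((Ar.row n).obj k),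
      f.hom ≫ toTop D' k = toTop D k ≫ t.hom) :
    ∃ g : D ≅ D', g.hom.app (Ar.top n) = t.hom := by
  choose e he using ht
  obtain ⟨a, ha⟩ := h.exists_hom_of_top h' t.hom fun k => ⟨_, he k⟩
  obtain ⟨b, hb⟩ := h'.exists_hom_of_top h t.inv fun k => ⟨(e k).inv, by
    rw [Iso.inv_comp_eq, ← Category.assoc, he k, Category.assoc, Iso.hom_inv_id, Category.comp_id]⟩
  exact ⟨⟨a, b, h.hom_ext_top h (by simp [ha, hb]), h'.hom_ext_top h' (by simp [ha, hb])⟩, ha⟩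

end IsSdot

/-! ### Diagrams on a polygon with an ear -/

namespace Ear

variable {N : ℕ} (i : Fin N)

/-- The edge `{i, i + 1}` of the polygon with vertices `0, …, N`, to which the ear
`{i, i + 1, i + 2}` of the polygon with vertices `0, …, N + 1` is glued. -/
abbrev edge : SimplexCategory.mk 1 ⟶ SimplexCategory.mk N := SimplexCategory.mkOfSucc i

/-- The side of the triangle along which an ear is glued. -/
abbrev chord : SimplexCategory.mk 1 ⟶ SimplexCategory.mk 2 := SimplexCategory.δ 1

/-- The inclusion of the polygon that remains when the tip `i + 1` of the ear is removed. -/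
abbrev face : SimplexCategory.mk N ⟶ SimplexCategory.mk (N + 1) :=
  SimplexCategory.δ i.succ.castSucc

/-- The ear `{i, i + 1, i + 2}`. -/
abbrev triangle : SimplexCategory.mk 2 ⟶ SimplexCategory.mk (N + 1) :=
  SimplexCategory.mkOfLeComp i.castSucc.castSucc i.succ.castSucc i.succ.succ
    (Fin.castSucc_le_castSucc_iff.2 (Fin.castSucc_le_succ i)) (Fin.castSucc_le_succ i.succ)

lemma face_zero : (face i).toOrderHom 0 = 0 :=
  Fin.succAbove_castSucc_of_lt _ _ (Fin.succ_pos i)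

lemma face_last : (face i).toOrderHom (Fin.last N) = Fin.last (N + 1) :=
  Fin.succAbove_castSucc_of_le _ _ (Fin.le_last _)

lemma face_edge_zero : (face i).toOrderHom ((edge i).toOrderHom 0) = (triangle i).toOrderHom 0 :=
  Fin.succAbove_castSucc_of_lt _ _ Fin.castSucc_lt_succ

lemma face_edge_one : (face i).toOrderHom ((edge i).toOrderHom 1) = (triangle i).toOrderHom 2 :=
  Fin.succAbove_castSucc_of_le _ _ le_rfl

lemma eq_tip_or_eq_face (k : Fin (N + 2)) :
    k = (triangle i).toOrderHom 1 ∨ ∃ k', k = (face i).toOrderHom k' :=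
  Fin.eq_self_or_eq_succAbove _ k

lemma edge_comp_face : edge i ≫ face i = chord ≫ triangle i := by
  ext k : 3
  match k with
  | 0 => exact face_edge_zero i
  | 1 => exact face_edge_one i

/-- The two copies of the edge along which an ear is glued, identified in `Ar[N + 1]`. -/
def chordIso : (Ar.map (face i)).obj ((Ar.map (edge i)).obj (Ar.top _)) ≅
    (Ar.map (triangle i)).obj (Ar.top _) :=
  eqToIso (Subtype.ext (Prod.ext (face_edge_zero i) (face_edge_one i)))

/-- Removing the tip of an ear preserves the top row. -/
def rowIso (k : Fin (N + 1)) :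
    (Ar.row _).obj ((face i).toOrderHom k) ≅ (Ar.map (face i)).obj ((Ar.row _).obj k) :=
  eqToIso (Subtype.ext (Prod.ext (face_zero i).symm rfl))

/-- Removing the tip of an ear preserves the last object of the top row. -/
def topIso : Ar.top (SimplexCategory.mk (N + 1)) ≅ (Ar.map (face i)).obj (Ar.top _) :=
  eqToIso (Subtype.ext (Prod.ext (face_zero i).symm (face_last i).symm))

end Ear

section EarHoms

variable {N : ℕ} {i : Fin N}

open Ear

variable {C : Type u} [Category.{v} C] {D D' : Ar (SimplexCategory.mk (N + 1)) ⥤ C}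

/-- The component at `(0, N + 1)` of a morphism given on the diagrams without the tip. -/
def extendTop (a : Ar.map (face i) ⋙ D ⟶ Ar.map (face i) ⋙ D') :
    D.obj (Ar.top _) ⟶ D'.obj (Ar.top _) :=
  D.map (topIso i).hom ≫ a.app (Ar.top _) ≫ D'.map (topIso i).inv

lemma comp_map_eq_comp_extendTop (a : Ar.map (face i) ⋙ D ⟶ Ar.map (face i) ⋙ D')
    (k : Fin (N + 1)) (t : (Ar.map (face i)).obj ((Ar.row _).obj k) ⟶ Ar.top _) :
    a.app ((Ar.row _).obj k) ≫ D'.map t = D.map t ≫ extendTop a := by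
  have nat := a.naturality ((Ar.row _).map (homOfLE (Fin.le_last k)))
  dsimp only [Functor.comp_map] at nat
  rw [extendTop, ← D.map_comp_assoc, Subsingleton.elim (t ≫ _) ((Ar.map (face i)).map _),
    reassoc_of% nat, ← D'.map_comp]
  rfl

lemma exists_row_face_hom (a : Ar.map (face i) ⋙ D ⟶ Ar.map (face i) ⋙ D') (k : Fin (N + 1)) :
    ∃ f : D.obj ((Ar.row _).obj ((face i).toOrderHom k)) ⟶
        D'.obj ((Ar.row _).obj ((face i).toOrderHom k)),
      f ≫ IsSdot.toTop D' _ = IsSdot.toTop D _ ≫ extendTop a := by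
  refine ⟨D.map (rowIso i k).hom ≫ a.app ((Ar.row _).obj k) ≫ D'.map (rowIso i k).inv, ?_⟩
  rw [Category.assoc, Category.assoc, IsSdot.toTop, Functor.comp_map, ← D'.map_comp,
    comp_map_eq_comp_extendTop, ← D.map_comp_assoc]
  rfl

variable [Preadditive C] [HasFiniteBiproducts C] [ExactCategory C]

lemma exists_row_tip_hom (hD' : IsSdot C D') (a : Ar.map (face i) ⋙ D ⟶ Ar.map (face i) ⋙ D')
    (b : Ar.map (triangle i) ⋙ D ⟶ Ar.map (triangle i) ⋙ D')
    (hab : a.app ((Ar.map (edge i)).obj (Ar.top _)) ≫ D'.map (chordIso i).hom =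
      D.map (chordIso i).hom ≫ b.app (Ar.top _)) :
    ∃ f : D.obj ((Ar.row _).obj ((triangle i).toOrderHom 1)) ⟶
        D'.obj ((Ar.row _).obj ((triangle i).toOrderHom 1)),
      f ≫ IsSdot.toTop D' _ = IsSdot.toTop D _ ≫ extendTop a := by
  let q := (Ar.row (SimplexCategory.mk N)).obj ((edge i).toOrderHom 1)
  let qEdge : q ⟶ (Ar.map (edge i)).obj (Ar.top _) := homOfLE ⟨Fin.zero_le _, le_rfl⟩
  let s : Ar (SimplexCategory.mk 2) := (Ar.row _).obj 1
  let sTop : s ⟶ Ar.top _ := (Ar.row _).map (homOfLE (Fin.le_last _))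
  let tipq : (Ar.row _).obj ((triangle i).toOrderHom 1) ⟶ (Ar.map (face i)).obj q :=
    homOfLE ⟨Fin.zero_le _, ((triangle i).toOrderHom.monotone (by decide)).trans
      (face_edge_one i).ge⟩
  let tips : (Ar.row _).obj ((triangle i).toOrderHom 1) ⟶ (Ar.map (triangle i)).obj s :=
    homOfLE ⟨Fin.zero_le _, le_rfl⟩
  let qTop : (Ar.map (face i)).obj q ⟶ Ar.top _ := homOfLE ⟨(face_zero i).le, Fin.le_last _⟩
  have sq : IsPullback (D'.map tipq) (D'.map tips)
      (D'.map ((Ar.map (face i)).map qEdge ≫ (chordIso i).hom))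
      (D'.map ((Ar.map (triangle i)).map sTop)) :=
    (hD'.bicartesianSq_map tipq tips ((Ar.map (face i)).map qEdge ≫ (chordIso i).hom)
      ((Ar.map (triangle i)).map sTop) (face_zero i).symm rfl (face_edge_one i) rfl).toIsPullback
  have ha := a.naturality qEdge
  have hb := b.naturality sTop
  dsimp only [Functor.comp_map] at ha hb
  refine ⟨sq.lift (D.map tipq ≫ a.app q) (D.map tips ≫ b.app s) ?_, ?_⟩
  · rw [Category.assoc, Category.assoc, D'.map_comp, ← reassoc_of% ha, hab, ← hb,
      ← D.map_comp_assoc, ← D.map_comp_assoc, ← D.map_comp_assoc]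
    rfl
  · have htop : IsSdot.toTop D' ((triangle i).toOrderHom 1) = D'.map tipq ≫ D'.map qTop :=
      D'.map_comp tipq qTop
    rw [htop, sq.lift_fst_assoc, Category.assoc, comp_map_eq_comp_extendTop, ← D.map_comp_assoc]
    rfl

lemma exists_hom_of_ear (hD : IsSdot C D) (hD' : IsSdot C D')
    (a : Ar.map (face i) ⋙ D ⟶ Ar.map (face i) ⋙ D')
    (b : Ar.map (triangle i) ⋙ D ⟶ Ar.map (triangle i) ⋙ D')
    (hab : a.app ((Ar.map (edge i)).obj (Ar.top _)) ≫ D'.map (chordIso i).hom =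
      D.map (chordIso i).hom ≫ b.app (Ar.top _)) :
    ∃ c : D ⟶ D', Functor.whiskerLeft (Ar.map (face i)) c = a ∧
      Functor.whiskerLeft (Ar.map (triangle i)) c = b := by
  obtain ⟨c, hc⟩ := hD.exists_hom_of_top hD' (extendTop a) fun k => by
    obtain rfl | ⟨k, rfl⟩ := eq_tip_or_eq_face i k
    exacts [exists_row_tip_hom hD' a b hab, exists_row_face_hom a k]
  have hca : Functor.whiskerLeft (Ar.map (face i)) c = a := by
    refine (hD.comp_map _).hom_ext_top (hD'.comp_map _) ?_
    refine (cancel_mono (D'.map (topIso i).inv)).1 ?_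
    refine Eq.trans ?_ (comp_map_eq_comp_extendTop a _ (topIso i).inv).symm
    rw [← hc]
    exact (c.naturality _).symm
  refine ⟨c, hca, (hD.comp_map _).hom_ext_top (hD'.comp_map _) ?_⟩
  rw [← cancel_epi (D.map (chordIso i).hom), ← hab, ← hca]
  exact c.naturality _

lemma hom_ext_of_face (hD : IsSdot C D) (hD' : IsSdot C D') {c c' : D ⟶ D'}
    (h : Functor.whiskerLeft (Ar.map (face i)) c = Functor.whiskerLeft (Ar.map (face i)) c') :
    c = c' := by
  refine hD.hom_ext_top hD' ?_
  rw [← cancel_mono (D'.map (topIso i).hom), ← c.naturality, ← c'.naturality]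
  exact congrArg (fun s => D.map _ ≫ s.app (Ar.top _)) h

end EarHoms

section EarObjects

open Ear IsSdot

lemma ofLE_comp_isoOfEqMk {C : Type u} [Category.{v} C] {X A B : C} {S T : Subobject X}
    {f : A ⟶ X} {g : B ⟶ X} [Mono f] [Mono g] (hS : S = Subobject.mk f) (hT : T = Subobject.mk g)
    {a : A ⟶ B} (ha : a ≫ g = f) (h : S ≤ T) :
    Subobject.ofLE S T h ≫ (Subobject.isoOfEqMk T g hT).hom =
      (Subobject.isoOfEqMk S f hS).hom ≫ a := by
  rw [← cancel_mono g, Category.assoc, Category.assoc, ha]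
  simp [Subobject.isoOfEqMk]

/-- The sequence obtained by inserting the value `x` at the tip of an ear. -/
def Ear.insertTip {α : Type*} {N : ℕ} (i : Fin N) (x : α) (f : Fin (N + 1) → α) :
    Fin (N + 2) → α :=
  i.succ.castSucc.insertNth (α := fun _ => α) x f

lemma Ear.insertTip_tip {α : Type*} {N : ℕ} (i : Fin N) (x : α) (f : Fin (N + 1) → α) :
    insertTip i x f i.succ.castSucc = x :=
  Fin.insertNth_apply_same _ _ _

lemma Ear.insertTip_face {α : Type*} {N : ℕ} (i : Fin N) (x : α) (f : Fin (N + 1) → α)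
    (k : Fin (N + 1)) : insertTip i x f (i.succ.castSucc.succAbove k) = f k :=
  Fin.insertNth_apply_succAbove _ _ _ _

lemma Ear.rel_insertTip {α : Type*} {r : α → α → Prop} (hrefl : ∀ a, r a a)
    (htrans : ∀ {a b c}, r a b → r b c → r a c) {N : ℕ} {i : Fin N} {f : Fin (N + 1) → α} {x : α}
    (hf : ∀ {k l}, k ≤ l → r (f k) (f l)) (h₀ : r (f i.castSucc) x) (h₁ : r x (f i.succ))
    {k l : Fin (N + 2)} (hkl : k ≤ l) : r (insertTip i x f k) (insertTip i x f l) := by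
  obtain rfl | ⟨k, rfl⟩ := Fin.eq_self_or_eq_succAbove i.succ.castSucc k <;>
    obtain rfl | ⟨l, rfl⟩ := Fin.eq_self_or_eq_succAbove i.succ.castSucc l
  · exact hrefl _
  · rw [insertTip_tip, insertTip_face]
    have hlt := hkl.lt_of_ne (Fin.succAbove_ne _ _).symm
    exact htrans h₁ (hf (Fin.castSucc_le_castSucc_iff.1
      ((Fin.lt_succAbove_iff_le_castSucc _ _).1 hlt)))
  · rw [insertTip_tip, insertTip_face]
    have hlt := hkl.lt_of_ne (Fin.succAbove_ne _ _)
    exact htrans (hf (Fin.le_castSucc_iff.2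
      (Fin.castSucc_lt_castSucc_iff.1 ((Fin.succAbove_lt_iff_castSucc_lt _ _).1 hlt)))) h₀
  · rw [insertTip_face, insertTip_face]
    exact hf (Fin.succAbove_le_succAbove_iff.1 hkl)

variable {C : Type u} [Category.{v} C] [Preadditive C] [HasFiniteBiproducts C] [ExactCategory C]

/-- An inclusion of subobjects that is an admissible monomorphism. -/
def AdLE {X : C} (S T : Subobject X) : Prop := ∃ h : S ≤ T, adMono C (Subobject.ofLE S T h)

lemma AdLE.trans {X : C} {S T U : Subobject X} (h : AdLE S T) (h' : AdLE T U) : AdLE S U := by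
  obtain ⟨hST, h⟩ := h
  obtain ⟨hTU, h'⟩ := h'
  exact ⟨hST.trans hTU, by simpa using adMono_comp h h'⟩

lemma adLE_mk {X A B : C} {f : A ⟶ X} {g : B ⟶ X} [Mono f] [Mono g] {a : A ⟶ B}
    (ha : a ≫ g = f) (h : adMono C a) : AdLE (Subobject.mk f) (Subobject.mk g) :=
  ⟨Subobject.mk_le_mk_of_comm a ha, adMono_of_iso h (Subobject.underlyingIso f).symm
    (Subobject.underlyingIso g).symm (by simp [← cancel_mono (Subobject.mk g).arrow, ha])⟩

lemma AdLE.refl {X : C} (S : Subobject X) : AdLE S S :=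
  ⟨le_rfl, by simpa using adMono_of_isIso (𝟙 (S : C))⟩

lemma exists_insertTip {N : ℕ} (i : Fin N) (M₀ : Fin (N + 1) ⥤ C)
    (hM₀ : ∀ {k l} (a : k ⟶ l), adMono C (M₀.map a)) {X : C} {l : M₀.obj i.castSucc ⟶ X}
    {s : X ⟶ M₀.obj i.succ} (hl : adMono C l) (hs : adMono C s)
    (hls : l ≫ s = M₀.map (homOfLE (Fin.castSucc_le_succ i))) :
    ∃ M : Fin (N + 2) ⥤ C, (∀ {k l} (a : k ⟶ l), adMono C (M.map a)) ∧
      ∃ (φ : vertexMap (face i) ⋙ M ≅ M₀) (φ₀ : M.obj ((triangle i).toOrderHom 0) ≅ M₀.obj _)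
        (ψ : M.obj ((triangle i).toOrderHom 1) ≅ X)
        (φ₁ : M.obj ((triangle i).toOrderHom 2) ≅ M₀.obj _),
        (∀ t, M.map t ≫ ψ.hom = φ₀.hom ≫ l) ∧ (∀ t, M.map t ≫ φ₁.hom = ψ.hom ≫ s) ∧
          (∀ t, M.map t ≫ φ₁.hom = φ₀.hom ≫ M₀.map (homOfLE (Fin.castSucc_le_succ i))) ∧
            ∀ t, M.map t ≫ φ₁.hom = φ.hom.app i.succ := by
  let p (k : Fin (N + 1)) : M₀.obj k ⟶ M₀.obj (Fin.last N) := M₀.map (homOfLE (Fin.le_last k))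
  have hp {k l} (h : k ≤ l) : M₀.map (homOfLE h) ≫ p l = p k := (M₀.map_comp _ _).symm
  have hmono (k : Fin (N + 1)) : Mono (p k) := mono_of_adMono (hM₀ _)
  have hmono_s : Mono (s ≫ p i.succ) := mono_of_adMono (adMono_comp hs (hM₀ _))
  have hl_p : l ≫ s ≫ p i.succ = p i.castSucc := by rw [reassoc_of% hls, hp]
  let c := insertTip i (Subobject.mk (s ≫ p i.succ)) fun k => Subobject.mk (p k)
  have hc_tip : c ((triangle i).toOrderHom 1) = Subobject.mk (s ≫ p i.succ) :=
    insertTip_tip _ _ _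
  have hc_face (k : Fin (N + 1)) : c ((face i).toOrderHom k) = Subobject.mk (p k) :=
    insertTip_face _ _ _ _
  have hc_zero : c ((triangle i).toOrderHom 0) = Subobject.mk (p i.castSucc) :=
    (congrArg c (face_edge_zero i).symm).trans (hc_face _)
  have hc_two : c ((triangle i).toOrderHom 2) = Subobject.mk (p i.succ) :=
    (congrArg c (face_edge_one i).symm).trans (hc_face _)
  have hc {k l} (h : k ≤ l) : AdLE (c k) (c l) :=
    rel_insertTip .refl .trans (fun h => adLE_mk (hp h) (hM₀ _)) (adLE_mk hl_p hl)
      (adLE_mk rfl hs) h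
  have hmonotone : Monotone c := fun _ _ h => (hc h).1
  exact ⟨hmonotone.functor ⋙ Subobject.underlying, fun a => (hc (leOfHom a)).2,
    NatIso.ofComponents (fun k => Subobject.isoOfEqMk _ _ (hc_face k)) fun a =>
      ofLE_comp_isoOfEqMk _ _ (hp (leOfHom a)) _,
    Subobject.isoOfEqMk _ _ hc_zero, Subobject.isoOfEqMk _ _ hc_tip,
    Subobject.isoOfEqMk _ _ hc_two,
    fun t => ofLE_comp_isoOfEqMk hc_zero hc_tip hl_p (hmonotone (leOfHom t)),
    fun t => ofLE_comp_isoOfEqMk hc_tip hc_two rfl (hmonotone (leOfHom t)),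
    fun t => ofLE_comp_isoOfEqMk hc_zero hc_two (hp _) (hmonotone (leOfHom t)),
    fun t => (ofLE_comp_isoOfEqMk (hc_face _) hc_two (Category.id_comp _)
      (hmonotone (leOfHom t))).trans (Category.comp_id _)⟩

lemma IsExactPair.exists_pullback_adMono {X Y Z W : C} {i : X ⟶ Y} {p : Y ⟶ Z}
    (h : IsExactPair i p) {j : W ⟶ Z} (hj : RelSdot.adMono C j) :
    ∃ (V : C) (l : X ⟶ V) (s : V ⟶ Y) (t : V ⟶ W),
      RelSdot.adMono C s ∧ IsExactPair l t ∧ l ≫ s = i ∧ s ≫ p = t ≫ j := by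
  obtain ⟨V, s, t, sq, -⟩ := ExactCategory.pullback_epi j _ h.adEpi
  exact ⟨V, sq.lift i 0 (h.zero.trans zero_comp.symm), s, t, adMono_of_isPullback sq h.adEpi hj,
    h.of_isPullback sq (sq.lift_fst _ _ _) (sq.lift_snd _ _ _), sq.lift_fst _ _ _, sq.w⟩

lemma IsExactPair.comp_iso {X Y Z X' Y' : C} {i : X ⟶ Y} {p : Y ⟶ Z} (h : IsExactPair i p)
    {i' : X' ⟶ Y'} (a : X' ≅ X) (b : Y' ≅ Y) (w : i' ≫ b.hom = a.hom ≫ i) :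
    IsExactPair i' (b.hom ≫ p) :=
  h.of_iso a.symm b.symm (Iso.refl _) (by simp [Iso.inv_comp_eq, ← reassoc_of% w]) (by simp)

lemma IsQuotientDiagram.exists_iso_of_top {n : SimplexCategory} {M : Fin (n.len + 1) ⥤ C}
    {D D' : Ar n ⥤ C} {π : Ar.snd n ⋙ M ⟶ D} (hπ : IsQuotientDiagram π) (hD' : IsSdot C D')
    (t : M.obj (Fin.last _) ⟶ D'.obj (Ar.top n))
    (ht : ∀ k, ∃ f : M.obj k ⟶ D'.obj ((Ar.row n).obj k),
      IsExactPair (M.map (homOfLE (Fin.zero_le k))) f ∧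
        f ≫ toTop D' k = M.map (homOfLE (Fin.le_last k)) ≫ t) :
    ∃ g : D ≅ D', π.app (Ar.top n) ≫ g.hom.app (Ar.top n) = t := by
  let σ (k : Fin (n.len + 1)) : M.obj k ⟶ D.obj ((Ar.row n).obj k) := π.app ((Ar.row n).obj k)
  have hσ (k) : IsExactPair (M.map (homOfLE (Fin.zero_le k))) (σ k) := hπ ((Ar.row n).obj k)
  have hσ_top (k) : σ k ≫ toTop D k = M.map (homOfLE (Fin.le_last k)) ≫ σ (Fin.last _) :=
    (π.naturality ((Ar.row n).map (homOfLE (Fin.le_last k)))).symm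
  have hiso (k) : ∃ e : D.obj ((Ar.row n).obj k) ≅ D'.obj ((Ar.row n).obj k),
      σ k ≫ e.hom ≫ toTop D' k = M.map (homOfLE (Fin.le_last k)) ≫ t := by
    obtain ⟨f, hf, hft⟩ := ht k
    obtain ⟨e, he⟩ := (hσ k).exists_iso hf (Iso.refl _) (Iso.refl _) (by simp)
    exact ⟨e, by rw [reassoc_of% he, Iso.refl_hom, Category.id_comp, hft]⟩
  choose e he using hiso
  have he_last : σ (Fin.last _) ≫ (e (Fin.last _)).hom = t := by
    have h := he (Fin.last _)
    change _ ≫ _ ≫ (Ar.row n ⋙ D').map (𝟙 _) = M.map (𝟙 _) ≫ t at h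
    simpa using h
  obtain ⟨g, hg⟩ := hπ.isSdot.exists_iso_of_top hD' (e (Fin.last _)) fun k => ⟨e k, by
    have := (hσ k).epi
    rw [← cancel_epi (σ k), he, ← he_last, ← Category.assoc, ← hσ_top, Category.assoc]⟩
  exact ⟨g, by rw [hg]; exact he_last⟩

lemma IsQuotientDiagram.exists_iso_of_triangle {M : Fin 3 ⥤ C}
    {D D' : Ar (SimplexCategory.mk 2) ⥤ C} {π : Ar.snd (SimplexCategory.mk 2) ⋙ M ⟶ D}
    (hπ : IsQuotientDiagram π) (hD' : IsSdot C D') {f : M.obj 1 ⟶ D'.obj ((Ar.row _).obj 1)}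
    {g : M.obj 2 ⟶ D'.obj (Ar.top _)} (hf : ∀ t : (0 : Fin 3) ⟶ 1, IsExactPair (M.map t) f)
    (hg : ∀ t : (0 : Fin 3) ⟶ 2, IsExactPair (M.map t) g)
    (hfg : ∀ t : (1 : Fin 3) ⟶ 2, f ≫ toTop D' 1 = M.map t ≫ g) :
    ∃ e : D ≅ D', π.app (Ar.top _) ≫ e.hom.app (Ar.top _) = g := by
  refine hπ.exists_iso_of_top hD' g fun k => ?_
  match k with
  | 0 =>
    have hz : IsZero (D'.obj ((Ar.row _).obj 0)) := hD'.zero 0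
    have h₀ : IsExactPair (M.map (𝟙 0)) (π.app (Ar.mk 0 0 le_rfl)) := hπ (Ar.mk 0 0 le_rfl)
    exact ⟨0, h₀.of_iso (Iso.refl _) (Iso.refl _) ((hπ.isSdot.zero 0).iso hz)
      ((Category.id_comp _).trans (Category.comp_id _).symm) (hz.eq_of_tgt _ _),
      zero_comp.trans (hg _).zero.symm⟩
  | 1 => exact ⟨f, hf _, hfg _⟩
  | 2 =>
    have hg_id : g ≫ (Ar.row _ ⋙ D').map (𝟙 2) = M.map (𝟙 2) ≫ g := by
      rw [M.map_id, Category.id_comp]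
      exact (congrArg (g ≫ ·) ((Ar.row _ ⋙ D').map_id 2)).trans (Category.comp_id g)
    exact ⟨g, hg _, hg_id⟩

lemma exists_of_ear {N : ℕ} {i : Fin N} {D₀ : Ar (SimplexCategory.mk N) ⥤ C}
    {D₁ : Ar (SimplexCategory.mk 2) ⥤ C} (h₀ : IsSdot C D₀) (h₁ : IsSdot C D₁)
    (ε : D₀.obj ((Ar.map (edge i)).obj (Ar.top _)) ≅ D₁.obj (Ar.top _)) :
    ∃ (D : Ar (SimplexCategory.mk (N + 1)) ⥤ C) (_ : IsSdot C D)
      (a : Ar.map (face i) ⋙ D ≅ D₀) (b : Ar.map (triangle i) ⋙ D ≅ D₁),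
      a.hom.app ((Ar.map (edge i)).obj (Ar.top _)) ≫ ε.hom =
        D.map (chordIso i).hom ≫ b.hom.app (Ar.top _) := by
  let p := (Ar.map (edge i)).obj (Ar.top _)
  have hx : IsExactPair (D₀.map ((Ar.row _).map (homOfLE p.2)))
      (D₀.map ((Ar.rowTo _).app p) ≫ ε.hom) :=
    (h₀.isQuotientDiagram p).of_iso (Iso.refl _) (Iso.refl _) ε (by simp) (Category.id_comp _)
  obtain ⟨X, l, s, t, hs, hlt, hls, hst⟩ :=
    hx.exists_pullback_adMono (h₁.adMono_row_map (homOfLE (Fin.le_last 1)))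
  obtain ⟨M, hM, φ, φ₀, ψ, φ₁, hl, hs, hls, hφ⟩ :=
    exists_insertTip i (Ar.row _ ⋙ D₀) h₀.adMono_row_map hlt.adMono hs hls
  obtain ⟨D, π, hπ⟩ := exists_isQuotientDiagram M hM
  obtain ⟨a, ha⟩ := (hπ.comp_map (face i)).exists_iso h₀.isQuotientDiagram φ
  have hψ {u} : (ψ.hom ≫ t) ≫ toTop D₁ 1 =
      M.map u ≫ φ₁.hom ≫ D₀.map ((Ar.rowTo _).app p) ≫ ε.hom := by
    rw [reassoc_of% hs u, Category.assoc]
    exact (congrArg (ψ.hom ≫ ·) hst.symm).trans (Category.assoc _ _ _).symm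
  obtain ⟨b, hb⟩ := (hπ.comp_map (triangle i)).exists_iso_of_triangle h₁
    (fun u => hlt.comp_iso φ₀ ψ (hl ((vertexMap (triangle i)).map u)))
    (fun u => hx.comp_iso φ₀ φ₁ (hls ((vertexMap (triangle i)).map u))) fun _ => hψ
  refine ⟨D, hπ.isSdot, a, b, ?_⟩
  have := hπ.epi_app ((Ar.map (face i)).obj p)
  have ha_p : π.app ((Ar.map (face i)).obj p) ≫ a.hom.app p =
      φ.hom.app i.succ ≫ D₀.map ((Ar.rowTo _).app p) := NatTrans.congr_app ha p
  let u : (face i).toOrderHom i.succ ⟶ (triangle i).toOrderHom 2 :=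
    (Ar.snd _).map (chordIso i).hom
  have hπ_p : π.app ((Ar.map (face i)).obj p) ≫ D.map (chordIso i).hom =
      M.map u ≫ π.app ((Ar.map (triangle i)).obj (Ar.top _)) :=
    (π.naturality (chordIso i).hom).symm
  rw [← cancel_epi (π.app ((Ar.map (face i)).obj p)), reassoc_of% ha_p, reassoc_of% hπ_p,
    ← hφ u, Category.assoc]
  exact (Category.assoc _ _ _).trans ((congrArg (M.map u ≫ ·)
    ((Category.assoc _ _ _).trans hb.symm)).trans (Category.assoc _ _ _).symm)

end EarObjects

/-! ### Homotopy pullbacks and isofibrations -/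

section HomotopyPullback

universe v₁ v₂ v₃ v₄ v₅ v₆ u₁ u₂ u₃ u₄ u₅ u₆

variable {X : Type u₁} [Category.{v₁} X] {Y : Type u₂} [Category.{v₂} Y]
  {Z : Type u₃} [Category.{v₃} Z] {W : Type u₄} [Category.{v₄} W]

/-- For a square of functors which is commutative up to the isomorphism `α`, the induced functor
from `X` to the homotopy pullback, whose objects are the triples `(y, z, f y ≅ g z)`, is fully
faithful. -/
structure IsFullyFaithfulSquare {P : X ⥤ Y} {Q : X ⥤ Z} {f : Y ⥤ W} {g : Z ⥤ W}
    (α : P ⋙ f ≅ Q ⋙ g) : Prop where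
  exists_hom : ∀ {x y : X} (a : P.obj x ⟶ P.obj y) (b : Q.obj x ⟶ Q.obj y),
    f.map a ≫ α.hom.app y = α.hom.app x ≫ g.map b → ∃ c : x ⟶ y, P.map c = a ∧ Q.map c = b
  hom_ext : ∀ {x y : X} {c c' : x ⟶ y}, P.map c = P.map c' → Q.map c = Q.map c' → c = c'

/-- A square of functors, commutative up to the isomorphism `α`, is a homotopy pullback: the
functor from `X` to the category of triples `(y, z, f y ≅ g z)` is an equivalence. -/
structure IsHomotopyPullback {P : X ⥤ Y} {Q : X ⥤ Z} {f : Y ⥤ W} {g : Z ⥤ W}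
    (α : P ⋙ f ≅ Q ⋙ g) : Prop extends IsFullyFaithfulSquare α where
  exists_obj : ∀ {y : Y} {z : Z} (e : f.obj y ≅ g.obj z),
    ∃ (x : X) (a : P.obj x ≅ y) (b : Q.obj x ≅ z),
      f.map a.hom ≫ e.hom = α.hom.app x ≫ g.map b.hom

lemma map_precomp_comp_eq {P : X ⥤ Y} {Q : X ⥤ Z} {f : Y ⥤ W} {g : Z ⥤ W}
    (α : P ⋙ f ≅ Q ⋙ g) {x x' : X} (κ : x' ⟶ x) {y : Y} {z : Z} {a : P.obj x ⟶ y}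
    {b : Q.obj x ⟶ z} {ε : f.obj y ⟶ g.obj z} (h : f.map a ≫ ε = α.hom.app x ≫ g.map b) :
    f.map (P.map κ ≫ a) ≫ ε = α.hom.app x' ≫ g.map (Q.map κ ≫ b) := by
  rw [f.map_comp, g.map_comp, Category.assoc, h, ← Category.assoc, ← Category.assoc]
  exact congrArg (· ≫ _) (α.hom.naturality κ)

section

variable {P : X ⥤ Y} {Q : X ⥤ Z} {f : Y ⥤ W} {g : Z ⥤ W} {α : P ⋙ f ≅ Q ⋙ g}

lemma IsFullyFaithfulSquare.exists_iso (H : IsFullyFaithfulSquare α) {x y : X}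
    (a : P.obj x ≅ P.obj y) (b : Q.obj x ≅ Q.obj y)
    (h : f.map a.hom ≫ α.hom.app y = α.hom.app x ≫ g.map b.hom) :
    ∃ c : x ≅ y, P.map c.hom = a.hom ∧ Q.map c.hom = b.hom := by
  obtain ⟨c, hc, hc'⟩ := H.exists_hom a.hom b.hom h
  obtain ⟨d, hd, hd'⟩ := H.exists_hom a.inv b.inv (by
    rw [← cancel_epi (f.map a.hom), ← f.map_comp_assoc, a.hom_inv_id, reassoc_of% h,
      ← g.map_comp, b.hom_inv_id]
    simp)
  exact ⟨⟨c, d, H.hom_ext (by simp [hc, hd]) (by simp [hc', hd']),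
    H.hom_ext (by simp [hc, hd]) (by simp [hc', hd'])⟩, hc, hc'⟩

namespace IsHomotopyPullback

lemma core (H : IsHomotopyPullback α) :
    IsHomotopyPullback (P := P.core) (Q := Q.core) (f := f.core) (g := g.core) α.core where
  exists_hom a b h := by
    obtain ⟨c, hc, hc'⟩ := H.exists_iso a.iso b.iso (congrArg (fun t => t.iso.hom) h)
    exact ⟨⟨c⟩, Core.hom_ext hc, Core.hom_ext hc'⟩
  hom_ext h h' := Core.hom_ext
    (H.hom_ext (congrArg (fun t => t.iso.hom) h) (congrArg (fun t => t.iso.hom) h'))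
  exists_obj e := by
    obtain ⟨x, a, b, h⟩ := H.exists_obj e.hom.iso
    exact ⟨⟨x⟩, Core.isoMk a, Core.isoMk b, Core.hom_ext h⟩

lemma of_right {Z' : Type u₅} [Category.{v₅} Z'] {W' : Type u₆} [Category.{v₆} W'] {R : Z ⥤ Z'}
    {k : W ⥤ W'} {g' : Z' ⥤ W'} {β : g ⋙ k ≅ R ⋙ g'} {γ : P ⋙ f ⋙ k ≅ (Q ⋙ R) ⋙ g'}
    (hβ : IsHomotopyPullback β) (hγ : IsHomotopyPullback γ)
    (hα : ∀ x, γ.hom.app x = k.map (α.hom.app x) ≫ β.hom.app (Q.obj x)) :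
    IsHomotopyPullback α where
  exists_hom {x y} a b h := by
    obtain ⟨c, hc, hc'⟩ := hγ.exists_hom a (R.map b) (by
      have hb : k.map (g.map b) ≫ β.hom.app (Q.obj y) =
        β.hom.app (Q.obj x) ≫ g'.map (R.map b) := β.hom.naturality b
      have h := congrArg (fun t => k.map t ≫ β.hom.app (Q.obj y)) h
      simp only [k.map_comp, Category.assoc, hb] at h
      simp only [hα, Category.assoc]
      exact h)
    refine ⟨c, hc, hβ.hom_ext ?_ hc'⟩
    rw [← cancel_epi (α.hom.app x), ← h, ← hc]
    exact (α.hom.naturality c).symm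
  hom_ext h h' := hγ.hom_ext h (congrArg R.map h')
  exists_obj {y z} e := by
    obtain ⟨x, a, b, hab⟩ := hγ.exists_obj (k.mapIso e ≪≫ β.app z)
    obtain ⟨c, hc, -⟩ := hβ.exists_iso ((α.app x).symm ≪≫ f.mapIso a ≪≫ e) b (by
      have hab : k.map (f.map a.hom) ≫ k.map e.hom ≫ β.hom.app z =
        γ.hom.app x ≫ g'.map b.hom := hab
      rw [hα, Category.assoc] at hab
      rw [← cancel_epi (k.map (α.hom.app x)), ← hab, ← k.map_comp_assoc, ← k.map_comp_assoc]
      simp)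
    exact ⟨x, a, c, by simp [hc]⟩

lemma congr {P' : X ⥤ Y} {Q' : X ⥤ Z} {f' : Y ⥤ W} {g' : Z ⥤ W} {h : P ⋙ f = Q ⋙ g}
    (H : IsHomotopyPullback (eqToIso h)) (hP : P = P') (hQ : Q = Q') (hf : f = f') (hg : g = g')
    (h' : P' ⋙ f' = Q' ⋙ g') : IsHomotopyPullback (eqToIso h') := by
  subst hP hQ hf hg
  exact H

lemma isEquivalence_of_comparison {X' : Type u₅} [Category.{v₅} X'] {Y' : Type u₆}
    [Category.{v₆} Y'] {L : X ⥤ X'} {M : Y ⥤ Y'} [M.IsEquivalence] {P' : X' ⥤ Y'} {Q' : X' ⥤ Z}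
    {f' : Y' ⥤ W} {β : P ⋙ M ⋙ f' ≅ (L ⋙ Q') ⋙ g} {β' : P' ⋙ f' ≅ Q' ⋙ g}
    (H : IsHomotopyPullback β) (H' : IsFullyFaithfulSquare β') (σ : P ⋙ M ≅ L ⋙ P')
    (hβ : ∀ x, β.hom.app x = f'.map (σ.hom.app x) ≫ β'.hom.app (L.obj x)) : L.IsEquivalence where
  faithful.map_injective {x y c c'} h := by
    refine H.hom_ext (M.map_injective ((cancel_mono (σ.hom.app y)).1 ?_)) (congrArg Q'.map h)
    exact (σ.hom.naturality c).trans ((congrArg (σ.hom.app x ≫ P'.map ·) h).trans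
      (σ.hom.naturality c').symm)
  full.map_surjective {x y} F := by
    obtain ⟨a, ha⟩ := M.map_surjective (σ.hom.app x ≫ P'.map F ≫ σ.inv.app y)
    have hF : f'.map (P'.map F) ≫ β'.hom.app (L.obj y) =
      β'.hom.app (L.obj x) ≫ g.map (Q'.map F) := β'.hom.naturality F
    obtain ⟨c, hc, hc'⟩ := H.exists_hom a (Q'.map F) (by
      simp only [Functor.comp_map, ha, hβ, f'.map_comp, Category.assoc, ← hF]
      rw [← f'.map_comp_assoc (σ.inv.app y), Iso.inv_hom_id_app, f'.map_id, Category.id_comp])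
    refine ⟨c, H'.hom_ext ((cancel_epi (σ.hom.app x)).1 ?_) hc'⟩
    refine (σ.hom.naturality c).symm.trans ?_
    simp [hc, ha]
  essSurj.mem_essImage z := by
    let m := M.objObjPreimageIso (P'.obj z)
    obtain ⟨x, a, b, hab⟩ := H.exists_obj (f'.mapIso m ≪≫ β'.app z)
    have hab : f'.map (M.map a.hom) ≫ f'.map m.hom ≫ β'.hom.app z =
      β.hom.app x ≫ g.map b.hom := hab
    obtain ⟨c, -⟩ := H'.exists_iso ((σ.app x).symm ≪≫ M.mapIso a ≪≫ m) b (by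
      simp only [Iso.trans_hom, Iso.symm_hom, Iso.app_inv, Functor.mapIso_hom, f'.map_comp,
        Category.assoc, hab, hβ]
      rw [← f'.map_comp_assoc, Iso.inv_hom_id_app]
      exact (congrArg (· ≫ _) (f'.map_id _)).trans (Category.id_comp _))
    exact ⟨x, ⟨c⟩⟩

end IsHomotopyPullback

end

lemma eqToIso_core {F G : X ⥤ Y} (h : F = G) :
    (eqToIso h).core = eqToIso (congrArg Functor.core h) := by
  subst h
  rfl

/-- A functor is an isofibration if isomorphisms out of `F x` lift strictly along `F`. -/
def IsIsofibration (F : X ⥤ Y) : Prop :=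
  ∀ {x : X} {y : Y} (θ : F.obj x ≅ y),
    ∃ (x' : X) (κ : x ≅ x') (e : F.obj x' = y), F.map κ.hom ≫ eqToHom e = θ.hom

namespace IsIsofibration

lemma core {F : X ⥤ Y} (hF : IsIsofibration F) : IsIsofibration F.core := fun {x y} θ => by
  obtain ⟨x', κ, e, hκ⟩ := hF θ.hom.iso
  obtain ⟨y⟩ := y
  obtain rfl : F.obj x' = y := e
  exact ⟨⟨x'⟩, Core.isoMk κ, rfl, Core.hom_ext hκ⟩

lemma fullSubcategory_lift {F : X ⥤ Y} (hF : IsIsofibration F) {P : ObjectProperty X}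
    [P.IsClosedUnderIsomorphisms] {Q : ObjectProperty Y} (hPQ : ∀ x, Q ((P.ι ⋙ F).obj x)) :
    IsIsofibration (Q.lift (P.ι ⋙ F) hPQ) := fun {x y} θ => by
  obtain ⟨x', κ, e, hκ⟩ := hF (Q.ι.mapIso θ)
  obtain ⟨y, hy⟩ := y
  obtain rfl : F.obj x' = y := e
  refine ⟨⟨x', P.prop_of_iso κ x.property⟩, P.isoMk κ, rfl, ObjectProperty.hom_ext _ hκ⟩

lemma whiskeringLeft {G : X ⥤ Y} (hG : Function.Injective G.obj) :
    IsIsofibration ((Functor.whiskeringLeft X Y Z).obj G) := fun {D E} θ => by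
  have exists_iso (y : Y) : ∃ (z : Z) (φ : D.obj y ≅ z), ∀ x (hx : G.obj x = y),
      ∃ hz : z = E.obj x, φ.hom ≫ eqToHom hz = D.map (eqToHom hx.symm) ≫ θ.hom.app x := by
    by_cases hy : ∃ x, G.obj x = y
    · obtain ⟨x, rfl⟩ := hy
      refine ⟨_, θ.app x, fun x' hx' => ?_⟩
      obtain rfl := hG hx'
      exact ⟨rfl, by simp⟩
    · exact ⟨_, Iso.refl _, fun x hx => (hy ⟨x, hx⟩).elim⟩
  choose z φ hz hφ using exists_iso
  have hφ_hom (x : X) : (φ (G.obj x)).hom = θ.hom.app x ≫ eqToHom (hz _ x rfl).symm := by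
    rw [← cancel_mono (eqToHom (hz _ x rfl)), hφ _ x rfl]
    simp
  have hφ_inv (x : X) : (φ (G.obj x)).inv = eqToHom (hz _ x rfl) ≫ θ.inv.app x := by
    rw [← cancel_epi (φ _).hom, Iso.hom_inv_id, hφ_hom]
    simp
  have hE : G ⋙ D.copyObj z φ = E := by
    refine CategoryTheory.Functor.ext (fun x => hz _ x rfl) fun x y a => ?_
    have ha : D.map (G.map a) ≫ θ.hom.app y = θ.hom.app x ≫ E.map a := θ.hom.naturality a
    change (φ _).inv ≫ D.map (G.map a) ≫ (φ _).hom = _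
    rw [hφ_hom, hφ_inv, Category.assoc, reassoc_of% ha, Iso.inv_hom_id_app_assoc]
    rfl
  refine ⟨D.copyObj z φ, D.isoCopyObj z φ, hE, ?_⟩
  ext x
  rw [NatTrans.comp_app, eqToHom_app]
  change (φ (G.obj x)).hom ≫ _ = _
  rw [hφ_hom]
  exact (Category.assoc _ _ _).trans ((congrArg (θ.hom.app x ≫ ·) (eqToHom_trans _ _)).trans
    (Category.comp_id _))

end IsIsofibration

end HomotopyPullback

/-! ### Strict pullbacks of simplicial groupoids -/

section SimplicialSquares

variable {k l m n : SimplexCategory}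

lemma map_comp_map_eq (X : SimplicialObject Grpd.{v, u}) {e : k ⟶ l} {δ : k ⟶ m} {d : l ⟶ n}
    {τ : m ⟶ n} (h : e ≫ d = δ ≫ τ) : X.map d.op ⋙ X.map e.op = X.map τ.op ⋙ X.map δ.op :=
  (X.map_comp d.op e.op).symm.trans
    ((congrArg (fun t => X.map (Quiver.Hom.op t)) h).trans (X.map_comp τ.op δ.op))

/-- The 2-cell filling the image of a commutative square under a simplicial groupoid. It is kept
as an isomorphism, although it is an equality, because its components compare objects. -/
def mapSqIso (X : SimplicialObject Grpd.{v, u}) {e : k ⟶ l} {δ : k ⟶ m} {d : l ⟶ n} {τ : m ⟶ n}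
    (h : e ≫ d = δ ≫ τ) : X.map d.op ⋙ X.map e.op ≅ X.map τ.op ⋙ X.map δ.op :=
  eqToIso (map_comp_map_eq X h)

lemma IsHomotopyPullback.mapSqIso_congr {X : SimplicialObject Grpd.{v, u}} {e e' : k ⟶ l}
    {δ δ' : k ⟶ m} {d d' : l ⟶ n} {τ τ' : m ⟶ n} {h : e ≫ d = δ ≫ τ}
    (H : IsHomotopyPullback (mapSqIso X h)) (he : e = e') (hδ : δ = δ') (hd : d = d')
    (hτ : τ = τ') (h' : e' ≫ d' = δ' ≫ τ') : IsHomotopyPullback (mapSqIso X h') := by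
  subst he hδ hd hτ
  exact H

/-- Removing an ear from a polygon exhibits the value of `X` on the polygon as a homotopy
pullback. -/
def IsEarLocal (X : SimplicialObject Grpd.{v, u}) : Prop :=
  ∀ {N : ℕ} (i : Fin N), IsHomotopyPullback (mapSqIso X (Ear.edge_comp_face i))

end SimplicialSquares

section StrictPullback

variable {X Y Z : SimplicialObject Grpd.{v, u}} (f : X ⟶ Z) (g : Y ⟶ Z) {k l m n : SimplexCategory}

variable {f g} in
/-- The restriction of a morphism `f x ⟶ g y`. -/
def relMap (α : m ⟶ n) {x : X.obj (op n)} {y : Y.obj (op n)}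
    (θ : (f.app (op n)).obj x ⟶ (g.app (op n)).obj y) :
    (f.app (op m)).obj ((X.map α.op).obj x) ⟶ (g.app (op m)).obj ((Y.map α.op).obj y) :=
  eqToHom (Functor.congr_obj (f.naturality α.op) x) ≫ (Z.map α.op).map θ ≫
    eqToHom (Functor.congr_obj (g.naturality α.op) y).symm

section RelMap

variable {f g}

lemma relMap_eqToHom (α : m ⟶ n) {x : X.obj (op n)} {y : Y.obj (op n)}
    (h : (f.app (op n)).obj x = (g.app (op n)).obj y)
    (h' : (f.app (op m)).obj ((X.map α.op).obj x) = (g.app (op m)).obj ((Y.map α.op).obj y)) :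
    relMap α (eqToHom h) = eqToHom h' := by
  simp [relMap, eqToHom_map]

lemma map_comp_relMap (α : m ⟶ n) {x x' : X.obj (op n)} {y : Y.obj (op n)} (c : x ⟶ x')
    (θ : (f.app (op n)).obj x' ⟶ (g.app (op n)).obj y) :
    (f.app (op m)).map ((X.map α.op).map c) ≫ relMap α θ =
      relMap α ((f.app (op n)).map c ≫ θ) := by
  have h := eqToHom_comp_map (f.naturality α.op) c
  dsimp only [relMap]
  rw [(Z.map α.op).map_comp, Category.assoc]
  exact (Category.assoc _ _ _).symm.trans
    ((congrArg (· ≫ _) h.symm).trans (Category.assoc _ _ _))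

lemma relMap_comp_map (α : m ⟶ n) {x : X.obj (op n)} {y y' : Y.obj (op n)}
    (θ : (f.app (op n)).obj x ⟶ (g.app (op n)).obj y) (c : y ⟶ y') :
    relMap α θ ≫ (g.app (op m)).map ((Y.map α.op).map c) =
      relMap α (θ ≫ (g.app (op n)).map c) := by
  have h := eqToHom_comp_map (g.naturality α.op).symm c
  dsimp only [relMap]
  rw [(Z.map α.op).map_comp, Category.assoc, Category.assoc, Category.assoc]
  exact congrArg (fun t => _ ≫ _ ≫ t) h

lemma map_inv_comp_relMap (α : m ⟶ n) {x x' : X.obj (op n)} {y : Y.obj (op n)}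
    {z₁ : X.obj (op m)} {z₂ : Y.obj (op m)} {κ : x ≅ x'}
    {ω : (f.app (op n)).obj x' ⟶ (g.app (op n)).obj y}
    {θ : (f.app (op n)).obj x ⟶ (g.app (op n)).obj y} (hκ : (f.app (op n)).map κ.hom ≫ ω = θ)
    {a₁ : (X.map α.op).obj x ⟶ z₁} {a₂ : (Y.map α.op).obj y ⟶ z₂}
    {μ : (f.app (op m)).obj z₁ ⟶ (g.app (op m)).obj z₂}
    (hθ : relMap α θ ≫ (g.app (op m)).map a₂ = (f.app (op m)).map a₁ ≫ μ) :
    (f.app (op m)).map ((X.map α.op).map κ.inv ≫ a₁) ≫ μ =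
      relMap α ω ≫ (g.app (op m)).map a₂ := by
  rw [(f.app (op m)).map_comp, Category.assoc, ← hθ, ← hκ, ← Category.assoc, map_comp_relMap,
    ← Category.assoc, ← (f.app (op n)).map_comp, κ.inv_hom_id, (f.app (op n)).map_id,
    Category.id_comp]

variable {e : k ⟶ l} {δ : k ⟶ m} {d : l ⟶ n} {τ : m ⟶ n} {h : e ≫ d = δ ≫ τ}
  {x : X.obj (op n)} {y : Y.obj (op n)}

lemma relMap_hom_ext (hZ : IsFullyFaithfulSquare (mapSqIso Z h))
    {θ θ' : (f.app (op n)).obj x ⟶ (g.app (op n)).obj y} (hd : relMap d θ = relMap d θ')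
    (hτ : relMap τ θ = relMap τ θ') : θ = θ' :=
  hZ.hom_ext ((cancel_mono _).1 ((cancel_epi _).1 hd)) ((cancel_mono _).1 ((cancel_epi _).1 hτ))

lemma exists_relMap_eq (hZ : IsFullyFaithfulSquare (mapSqIso Z h))
    (θ : (f.app (op l)).obj ((X.map d.op).obj x) ⟶ (g.app (op l)).obj ((Y.map d.op).obj y))
    (ψ : (f.app (op m)).obj ((X.map τ.op).obj x) ⟶ (g.app (op m)).obj ((Y.map τ.op).obj y))
    (w : relMap e θ ≫ (g.app (op k)).map ((mapSqIso Y h).hom.app y) =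
      (f.app (op k)).map ((mapSqIso X h).hom.app x) ≫ relMap δ ψ) :
    ∃ φ : (f.app (op n)).obj x ⟶ (g.app (op n)).obj y, relMap d φ = θ ∧ relMap τ φ = ψ := by
  obtain ⟨φ, hθ, hψ⟩ := hZ.exists_hom
    (eqToHom (Functor.congr_obj (f.naturality d.op) x).symm ≫ θ ≫
      eqToHom (Functor.congr_obj (g.naturality d.op) y))
    (eqToHom (Functor.congr_obj (f.naturality τ.op) x).symm ≫ ψ ≫
      eqToHom (Functor.congr_obj (g.naturality τ.op) y)) (by
    simpa [relMap, mapSqIso, eqToHom_map, eqToHom_comp_iff, comp_eqToHom_iff] using w)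
  refine ⟨φ, ?_, ?_⟩
  · simp [relMap, hθ]
  · simp [relMap, hψ]

lemma exists_relMap_comp_eq (hZ : IsFullyFaithfulSquare (mapSqIso Z h)) {y₁ : X.obj (op l)}
    {y₂ : Y.obj (op l)} {z₁ : X.obj (op m)} {z₂ : Y.obj (op m)}
    {μ : (f.app (op l)).obj y₁ ⟶ (g.app (op l)).obj y₂}
    {ν : (f.app (op m)).obj z₁ ⟶ (g.app (op m)).obj z₂}
    {ε₁ : (X.map e.op).obj y₁ ⟶ (X.map δ.op).obj z₁}
    {ε₂ : (Y.map e.op).obj y₂ ⟶ (Y.map δ.op).obj z₂}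
    (w : relMap e μ ≫ (g.app (op k)).map ε₂ = (f.app (op k)).map ε₁ ≫ relMap δ ν)
    (a₁ : (X.map d.op).obj x ⟶ y₁) (b₁ : (X.map τ.op).obj x ⟶ z₁)
    (a₂ : (Y.map d.op).obj y ⟶ y₂) (b₂ : (Y.map τ.op).obj y ⟶ z₂)
    (h₁ : (X.map e.op).map a₁ ≫ ε₁ = (mapSqIso X h).hom.app x ≫ (X.map δ.op).map b₁)
    (h₂ : (Y.map e.op).map a₂ ≫ ε₂ = (mapSqIso Y h).hom.app y ≫ (Y.map δ.op).map b₂) :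
    ∃ θ : (f.app (op n)).obj x ⟶ (g.app (op n)).obj y,
      relMap d θ ≫ (g.app (op l)).map a₂ = (f.app (op l)).map a₁ ≫ μ ∧
      relMap τ θ ≫ (g.app (op m)).map b₂ = (f.app (op m)).map b₁ ≫ ν := by
  obtain ⟨θ, hθ⟩ : ∃ θ, θ ≫ (g.app (op l)).map a₂ = (f.app (op l)).map a₁ ≫ μ :=
    ⟨((f.app (op l)).map a₁ ≫ μ) ≫ inv ((g.app (op l)).map a₂), by simp⟩
  obtain ⟨ψ, hψ⟩ : ∃ ψ, ψ ≫ (g.app (op m)).map b₂ = (f.app (op m)).map b₁ ≫ ν :=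
    ⟨((f.app (op m)).map b₁ ≫ ν) ≫ inv ((g.app (op m)).map b₂), by simp⟩
  have hsq : relMap e θ ≫ (g.app (op k)).map ((mapSqIso Y h).hom.app y) =
      (f.app (op k)).map ((mapSqIso X h).hom.app x) ≫ relMap δ ψ := by
    refine (cancel_mono ((g.app (op k)).map ((Y.map δ.op).map b₂))).1 ?_
    calc (relMap e θ ≫ (g.app (op k)).map ((mapSqIso Y h).hom.app y)) ≫
          (g.app (op k)).map ((Y.map δ.op).map b₂)
        = relMap e θ ≫ (g.app (op k)).map ((Y.map e.op).map a₂ ≫ ε₂) := by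
          rw [h₂, Category.assoc, ← (g.app (op k)).map_comp]
      _ = (relMap e θ ≫ (g.app (op k)).map ((Y.map e.op).map a₂)) ≫ (g.app (op k)).map ε₂ := by
          rw [(g.app (op k)).map_comp, Category.assoc]
      _ = (f.app (op k)).map ((X.map e.op).map a₁) ≫ relMap e μ ≫ (g.app (op k)).map ε₂ := by
          rw [relMap_comp_map, hθ, ← map_comp_relMap, Category.assoc]
      _ = (f.app (op k)).map ((X.map e.op).map a₁ ≫ ε₁) ≫ relMap δ ν := by
          rw [w, (f.app (op k)).map_comp, Category.assoc]
      _ = (f.app (op k)).map ((mapSqIso X h).hom.app x) ≫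
            (f.app (op k)).map ((X.map δ.op).map b₁) ≫ relMap δ ν := by
          rw [h₁, (f.app (op k)).map_comp, Category.assoc]
      _ = ((f.app (op k)).map ((mapSqIso X h).hom.app x) ≫ relMap δ ψ) ≫
            (g.app (op k)).map ((Y.map δ.op).map b₂) := by
          rw [map_comp_relMap, ← hψ, ← relMap_comp_map, Category.assoc]
  obtain ⟨φ, rfl, rfl⟩ := exists_relMap_eq hZ θ ψ hsq
  exact ⟨φ, hθ, hψ⟩

end RelMap

lemma GrpdPullback.fst_eqToHom {X Y Z : Grpd.{v, u}} {f : X ⟶ Z} {g : Y ⟶ Z}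
    {p q : GrpdPullback f g} (h : p = q) :
    Hom.fst (eqToHom h) = eqToHom (congrArg GrpdPullback.fst h) := by
  subst h
  rfl

lemma GrpdPullback.snd_eqToHom {X Y Z : Grpd.{v, u}} {f : X ⟶ Z} {g : Y ⟶ Z}
    {p q : GrpdPullback f g} (h : p = q) :
    Hom.snd (eqToHom h) = eqToHom (congrArg GrpdPullback.snd h) := by
  subst h
  rfl

variable {f g} {e : k ⟶ l} {δ : k ⟶ m} {d : l ⟶ n} {τ : m ⟶ n}

lemma fst_mapSqIso_hom_app (h : e ≫ d = δ ≫ τ) (x : (simplicialPullback f g).obj (op n)) :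
    GrpdPullback.Hom.fst ((mapSqIso (simplicialPullback f g) h).hom.app x) =
      (mapSqIso X h).hom.app (GrpdPullback.fst x) :=
  (congrArg GrpdPullback.Hom.fst
    (eqToHom_app (map_comp_map_eq (simplicialPullback f g) h) x)).trans
    ((GrpdPullback.fst_eqToHom _).trans (eqToHom_app (map_comp_map_eq X h) _).symm)

lemma snd_mapSqIso_hom_app (h : e ≫ d = δ ≫ τ) (x : (simplicialPullback f g).obj (op n)) :
    GrpdPullback.Hom.snd ((mapSqIso (simplicialPullback f g) h).hom.app x) =
      (mapSqIso Y h).hom.app (GrpdPullback.snd x) :=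
  (congrArg GrpdPullback.Hom.snd
    (eqToHom_app (map_comp_map_eq (simplicialPullback f g) h) x)).trans
    ((GrpdPullback.snd_eqToHom _).trans (eqToHom_app (map_comp_map_eq Y h) _).symm)

lemma relMap_eq (α : m ⟶ n) (x : (simplicialPullback f g).obj (op n)) :
    relMap α (eqToHom (GrpdPullback.eq x)) =
      eqToHom (GrpdPullback.eq (((simplicialPullback f g).map α.op).obj x)) :=
  relMap_eqToHom α _ _

variable {h : e ≫ d = δ ≫ τ}

lemma relMap_comm_of_hom (α : m ⟶ n) {x y : (simplicialPullback f g).obj (op n)}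
    {c₁ : GrpdPullback.fst x ⟶ GrpdPullback.fst y} {c₂ : GrpdPullback.snd x ⟶ GrpdPullback.snd y}
    (a : ((simplicialPullback f g).map α.op).obj x ⟶ ((simplicialPullback f g).map α.op).obj y)
    (h₁ : (X.map α.op).map c₁ = GrpdPullback.Hom.fst a)
    (h₂ : (Y.map α.op).map c₂ = GrpdPullback.Hom.snd a) :
    relMap α ((f.app (op n)).map c₁ ≫ eqToHom (GrpdPullback.eq y)) =
      relMap α (eqToHom (GrpdPullback.eq x) ≫ (g.app (op n)).map c₂) :=
  (map_comp_relMap α _ _).symm.trans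
    ((congrArg₂ (fun s t => (f.app (op m)).map s ≫ t) h₁ (relMap_eq α y)).trans
      ((GrpdPullback.Hom.w a).trans
        ((congrArg₂ (fun s t => s ≫ (g.app (op m)).map t) (relMap_eq α x).symm h₂.symm).trans
          (relMap_comp_map α _ _))))

lemma exists_simplicialPullback_hom (hX : IsFullyFaithfulSquare (mapSqIso X h))
    (hY : IsFullyFaithfulSquare (mapSqIso Y h)) (hZ : IsFullyFaithfulSquare (mapSqIso Z h))
    {x y : (simplicialPullback f g).obj (op n)}
    (a : ((simplicialPullback f g).map d.op).obj x ⟶ ((simplicialPullback f g).map d.op).obj y)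
    (b : ((simplicialPullback f g).map τ.op).obj x ⟶ ((simplicialPullback f g).map τ.op).obj y)
    (w : ((simplicialPullback f g).map e.op).map a ≫
        (mapSqIso (simplicialPullback f g) h).hom.app y =
      (mapSqIso (simplicialPullback f g) h).hom.app x ≫
        ((simplicialPullback f g).map δ.op).map b) :
    ∃ c : x ⟶ y, ((simplicialPullback f g).map d.op).map c = a ∧
      ((simplicialPullback f g).map τ.op).map c = b := by
  obtain ⟨c₁, ha₁, hb₁⟩ := hX.exists_hom (GrpdPullback.Hom.fst a) (GrpdPullback.Hom.fst b)
    ((congrArg (_ ≫ ·) (fst_mapSqIso_hom_app h y).symm).trans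
      ((congrArg GrpdPullback.Hom.fst w).trans (congrArg (· ≫ _) (fst_mapSqIso_hom_app h x))))
  obtain ⟨c₂, ha₂, hb₂⟩ := hY.exists_hom (GrpdPullback.Hom.snd a) (GrpdPullback.Hom.snd b)
    ((congrArg (_ ≫ ·) (snd_mapSqIso_hom_app h y).symm).trans
      ((congrArg GrpdPullback.Hom.snd w).trans (congrArg (· ≫ _) (snd_mapSqIso_hom_app h x))))
  exact ⟨⟨c₁, c₂, relMap_hom_ext hZ (relMap_comm_of_hom d a ha₁ ha₂)
    (relMap_comm_of_hom τ b hb₁ hb₂)⟩, GrpdPullback.Hom.ext ha₁ ha₂, GrpdPullback.Hom.ext hb₁ hb₂⟩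

lemma exists_simplicialPullback_obj (hX : IsHomotopyPullback (mapSqIso X h))
    (hY : IsHomotopyPullback (mapSqIso Y h)) (hZ : IsFullyFaithfulSquare (mapSqIso Z h))
    (hf : IsIsofibration (f.app (op n))) {y : (simplicialPullback f g).obj (op l)}
    {z : (simplicialPullback f g).obj (op m)}
    (ε : ((simplicialPullback f g).map e.op).obj y ≅ ((simplicialPullback f g).map δ.op).obj z) :
    ∃ (x : (simplicialPullback f g).obj (op n)) (a : ((simplicialPullback f g).map d.op).obj x ≅ y)
      (b : ((simplicialPullback f g).map τ.op).obj x ≅ z),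
      ((simplicialPullback f g).map e.op).map a.hom ≫ ε.hom =
        (mapSqIso (simplicialPullback f g) h).hom.app x ≫
          ((simplicialPullback f g).map δ.op).map b.hom := by
  obtain ⟨x₁, a₁, b₁, h₁⟩ :=
    hX.exists_obj ((GrpdPullback.π₁ (f.app (op k)) (g.app (op k))).mapIso ε)
  obtain ⟨x₂, a₂, b₂, h₂⟩ :=
    hY.exists_obj ((GrpdPullback.π₂ (f.app (op k)) (g.app (op k))).mapIso ε)
  have w : relMap e (eqToHom (GrpdPullback.eq y)) ≫
      (g.app (op k)).map (GrpdPullback.Hom.snd ε.hom) =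
      (f.app (op k)).map (GrpdPullback.Hom.fst ε.hom) ≫ relMap δ (eqToHom (GrpdPullback.eq z)) :=
    (congrArg (· ≫ _) (relMap_eq e y)).trans
      ((GrpdPullback.Hom.w ε.hom).symm.trans (congrArg (_ ≫ ·) (relMap_eq δ z).symm))
  obtain ⟨θ, hd, hτ⟩ := exists_relMap_comp_eq hZ w a₁.hom b₁.hom a₂.hom b₂.hom h₁ h₂
  obtain ⟨x, κ, hx, hκ⟩ := hf (asIso θ)
  let x' : (simplicialPullback f g).obj (op n) := GrpdPullback.mk x x₂ hx
  let a : ((simplicialPullback f g).map d.op).obj x' ⟶ y :=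
    ⟨(X.map d.op).map κ.inv ≫ a₁.hom, a₂.hom,
      (map_inv_comp_relMap d hκ hd).trans (congrArg (· ≫ _) (relMap_eq d x'))⟩
  let b : ((simplicialPullback f g).map τ.op).obj x' ⟶ z :=
    ⟨(X.map τ.op).map κ.inv ≫ b₁.hom, b₂.hom,
      (map_inv_comp_relMap τ hκ hτ).trans (congrArg (· ≫ _) (relMap_eq τ x'))⟩
  refine ⟨x', asIso a, asIso b, GrpdPullback.Hom.ext ?_ ?_⟩
  · refine Eq.trans ?_ (congrArg (· ≫ (X.map δ.op).map ((X.map τ.op).map κ.inv ≫ b₁.hom))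
      (fst_mapSqIso_hom_app h x').symm)
    exact map_precomp_comp_eq (mapSqIso X h) κ.inv h₁
  · exact h₂.trans (congrArg (· ≫ _) (snd_mapSqIso_hom_app h x').symm)

lemma isHomotopyPullback_simplicialPullback (hX : IsHomotopyPullback (mapSqIso X h))
    (hY : IsHomotopyPullback (mapSqIso Y h)) (hZ : IsFullyFaithfulSquare (mapSqIso Z h))
    (hf : IsIsofibration (f.app (op n))) :
    IsHomotopyPullback (mapSqIso (simplicialPullback f g) h) where
  exists_hom a b w := exists_simplicialPullback_hom hX.toIsFullyFaithfulSquare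
    hY.toIsFullyFaithfulSquare hZ a b w
  hom_ext w w' := GrpdPullback.Hom.ext
    (hX.hom_ext (congrArg GrpdPullback.Hom.fst w) (congrArg GrpdPullback.Hom.fst w'))
    (hY.hom_ext (congrArg GrpdPullback.Hom.snd w) (congrArg GrpdPullback.Hom.snd w'))
  exists_obj ε := exists_simplicialPullback_obj hX hY hZ hf ε

end StrictPullback

/-! ### Ear locality of the relative construction -/

section SdotLocality

variable {A : Type u} [Category.{v} A] [Preadditive A] [HasFiniteBiproducts A] [ExactCategory A]

instance sdotProp_isClosedUnderIsomorphisms (n : SimplexCategory) :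
    (sdotProp A n).IsClosedUnderIsomorphisms where
  of_iso φ hD := IsSdot.of_iso hD φ

variable (A) in
/-- Restriction of diagrams along a map in the simplex category; `sdot A` consists of the cores
of these functors. -/
def sdotRes {m n : SimplexCategory} (α : m ⟶ n) :
    (sdotProp A n).FullSubcategory ⥤ (sdotProp A m).FullSubcategory :=
  (sdotProp A m).lift ((sdotProp A n).ι ⋙ (Functor.whiskeringLeft _ _ A).obj (Ar.map α))
    (fun D => D.property.comp_map α)

lemma sdotRes_comp_sdotRes {k l m n : SimplexCategory} {e : k ⟶ l} {δ : k ⟶ m} {d : l ⟶ n}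
    {τ : m ⟶ n} (h : e ≫ d = δ ≫ τ) :
    sdotRes A d ⋙ sdotRes A e = sdotRes A τ ⋙ sdotRes A δ :=
  congrArg (sdotRes A) h

lemma eqToHom_sdotRes_app {m n : SimplexCategory} {α β : m ⟶ n} (h : α = β)
    (x : (sdotProp A n).FullSubcategory) (hx : (sdotRes A α).obj x = (sdotRes A β).obj x)
    (p : Ar m) (r : (Ar.map α).obj p ⟶ (Ar.map β).obj p) :
    (eqToHom hx).hom.app p = x.obj.map r := by
  subst h
  exact (x.obj.map_id _).symm

lemma eqToIso_sdotRes_app_top {N : ℕ} (i : Fin N)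
    (x : (sdotProp A (SimplexCategory.mk (N + 1))).FullSubcategory) :
    ((eqToIso (sdotRes_comp_sdotRes (A := A) (Ear.edge_comp_face i))).hom.app x).hom.app
      (Ar.top _) = x.obj.map (Ear.chordIso i).hom :=
  (congrArg (fun t : (sdotRes A (Ear.edge i)).obj ((sdotRes A (Ear.face i)).obj x) ⟶
      (sdotRes A Ear.chord).obj ((sdotRes A (Ear.triangle i)).obj x) => t.hom.app (Ar.top _))
    (eqToHom_app (sdotRes_comp_sdotRes (Ear.edge_comp_face i)) x)).trans
    (eqToHom_sdotRes_app (Ear.edge_comp_face i) x _ _ _)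

lemma isHomotopyPullback_sdotRes {N : ℕ} (i : Fin N) :
    IsHomotopyPullback (eqToIso (sdotRes_comp_sdotRes (A := A) (Ear.edge_comp_face i))) where
  exists_hom {x y} a b w := by
    obtain ⟨c, hc, hc'⟩ := exists_hom_of_ear x.property y.property a.hom b.hom
      ((congrArg (_ ≫ ·) (eqToIso_sdotRes_app_top i y).symm).trans
        ((congrArg (fun s => s.hom.app (Ar.top _)) w).trans
          (congrArg (· ≫ _) (eqToIso_sdotRes_app_top i x))))
    exact ⟨ObjectProperty.homMk c, ObjectProperty.hom_ext _ hc, ObjectProperty.hom_ext _ hc'⟩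
  hom_ext {x y c c'} w _ := ObjectProperty.hom_ext _
    (hom_ext_of_face x.property y.property (congrArg (fun s => s.hom) w))
  exists_obj {y z} ε := by
    obtain ⟨D, hD, a, b, hab⟩ := exists_of_ear y.property z.property
      (((sdotProp A _).ι.mapIso ε).app (Ar.top _))
    refine ⟨⟨D, hD⟩, (sdotProp A _).isoMk a, (sdotProp A _).isoMk b, ObjectProperty.hom_ext _ ?_⟩
    refine IsSdot.hom_ext_top (hD.comp_map (Ear.edge i ≫ Ear.face i))
      (z.property.comp_map Ear.chord) ?_
    exact hab.trans (congrArg (· ≫ b.hom.app (Ar.top _)) (eqToIso_sdotRes_app_top i ⟨D, hD⟩)).symm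

lemma isEarLocal_sdot : IsEarLocal (sdot A) := fun i => by
  have h := (isHomotopyPullback_sdotRes (A := A) i).core
  rw [eqToIso_core] at h
  exact h

end SdotLocality

namespace Ear

variable {N : ℕ} (i : Fin N)

lemma coneFunctor_map_face : coneFunctor.map (face i) = face i.succ := by
  ext k : 3
  induction k using Fin.cases with
  | zero => rfl
  | succ k => exact (Fin.succ_succAbove_succ i.succ.castSucc k).symm

lemma coneIncl_comp_coneFunctor_map_edge :
    coneIncl.app _ ≫ coneFunctor.map (edge i) = edge i.succ := by
  ext k : 3
  match k with
  | 0 | 1 => rfl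

lemma coneIncl_comp_coneFunctor_map_triangle :
    coneIncl.app _ ≫ coneFunctor.map (triangle i) = triangle i.succ := by
  ext k : 3
  match k with
  | 0 | 1 | 2 => rfl

lemma coneIncl_app_one : coneIncl.app (SimplexCategory.mk 1) = edge 1 := by
  ext k : 3
  match k with
  | 0 | 1 => rfl

lemma coneIncl_app_two : coneIncl.app (SimplexCategory.mk 2) = triangle 1 := by
  ext k : 3
  match k with
  | 0 | 1 | 2 => rfl

lemma coneFunctor_map_chord : coneFunctor.map chord = face 1 := by
  ext k : 3
  match k with
  | 0 | 1 | 2 => rfl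

end Ear

lemma isEarLocal_initialPath {X : SimplicialObject Grpd.{v, u}} (hX : IsEarLocal X) :
    IsEarLocal (initialPath X) := fun i => by
  have hβ : IsHomotopyPullback (mapSqIso X (coneIncl.naturality Ear.chord).symm) :=
    (hX 1).mapSqIso_congr Ear.coneIncl_app_one.symm rfl Ear.coneFunctor_map_chord.symm
      Ear.coneIncl_app_two.symm _
  have hsq : (coneIncl.app _ ≫ coneFunctor.map (Ear.edge i)) ≫ coneFunctor.map (Ear.face i) =
      Ear.chord ≫ coneIncl.app _ ≫ coneFunctor.map (Ear.triangle i) :=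
    congrArg (coneIncl.app _ ≫ coneFunctor.map ·) (Ear.edge_comp_face i)
  have hγ : IsHomotopyPullback (mapSqIso X hsq) :=
    (hX i.succ).mapSqIso_congr (Ear.coneIncl_comp_coneFunctor_map_edge i).symm rfl
      (Ear.coneFunctor_map_face i).symm (Ear.coneIncl_comp_coneFunctor_map_triangle i).symm _
  have hcomp : (initialPath X).map (Ear.face i).op ⋙
      (initialPath X).map (Ear.edge i).op ⋙ X.map (coneIncl.app _).op =
        ((initialPath X).map (Ear.triangle i).op ⋙ X.map (coneIncl.app _).op) ⋙
          X.map Ear.chord.op :=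
    (congrArg (· ⋙ X.map (coneIncl.app _).op)
      (map_comp_map_eq (initialPath X) (Ear.edge_comp_face i))).trans
      (congrArg (X.map (coneFunctor.map (Ear.triangle i)).op ⋙ ·)
        (map_comp_map_eq X (coneIncl.naturality Ear.chord).symm))
  refine IsHomotopyPullback.of_right hβ
    (hγ.congr rfl (X.map_comp _ _) (X.map_comp _ _) rfl hcomp) fun x => ?_
  exact (eqToHom_app hcomp x).trans ((eqToHom_trans _ _).symm.trans (congrArg₂ (· ≫ ·)
    (((X.map (coneIncl.app (SimplexCategory.mk 1)).op).congr_map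
      (eqToHom_app (map_comp_map_eq (initialPath X) (Ear.edge_comp_face i)) x)).trans
      (eqToHom_map _ _)).symm
    (eqToHom_app (map_comp_map_eq X (coneIncl.naturality Ear.chord).symm) _).symm))

section Relative

namespace Ar

lemma map_obj_injective {m n : SimplexCategory} {α : m ⟶ n}
    (hα : Function.Injective α.toOrderHom) : Function.Injective (Ar.map α).obj :=
  fun _ _ h => Subtype.ext (Prod.ext (hα (congrArg (fun p => p.1.1) h))
    (hα (congrArg (fun p => p.1.2) h)))

end Ar

variable {A B : Type u} [Category.{v} A] [Preadditive A] [HasFiniteBiproducts A]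
  [ExactCategory A] [Category.{v} B] [Preadditive B] [HasFiniteBiproducts B] [ExactCategory B]

lemma isIsofibration_initialPathD₀_sdot (n : SimplexCategory) :
    IsIsofibration ((initialPathD₀ (sdot A)).app (op n)) :=
  have isIsofibration_restrict :
      IsIsofibration ((Functor.whiskeringLeft _ _ A).obj (Ar.map (coneIncl.app n))) :=
    IsIsofibration.whiskeringLeft (Ar.map_obj_injective (α := coneIncl.app n)
      (Fin.succ_injective _))
  IsIsofibration.core (F := sdotRes A (coneIncl.app n))
    (IsIsofibration.fullSubcategory_lift isIsofibration_restrict _)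

lemma isEarLocal_simplicialPullback {X Y Z : SimplicialObject Grpd.{v, u}} {f : X ⟶ Z} {g : Y ⟶ Z}
    (hX : IsEarLocal X) (hY : IsEarLocal Y) (hZ : IsEarLocal Z)
    (hf : ∀ n, IsIsofibration (f.app n)) : IsEarLocal (simplicialPullback f g) :=
  fun i => isHomotopyPullback_simplicialPullback (hX i) (hY i) (hZ i).toIsFullyFaithfulSquare
    (hf _)

lemma isEarLocal_relSdot (F : A ⥤ B) [ExactFunctor F] : IsEarLocal (relSdot F) :=
  isEarLocal_simplicialPullback (isEarLocal_initialPath isEarLocal_sdot) isEarLocal_sdot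
    isEarLocal_sdot fun n => isIsofibration_initialPathD₀_sdot n.unop

end Relative

/-! ### Ears of triangulations -/

namespace IsTriangulation

variable {n : ℕ} {T : SimpleGraph (Fin (n + 1))}

lemma adj_of_forall_not_crossing (hT : IsTriangulation T) {a b : Fin (n + 1)} (hab : a < b)
    (h : ∀ x y, T.Adj x y → ¬ (a < x ∧ x < b ∧ b < y) ∧ ¬ (x < a ∧ a < y ∧ y < b)) :
    T.Adj a b := by
  have noncrossing : NonCrossing (T ⊔ SimpleGraph.edge a b) := by
    rintro i k j l hik hkj hjl ⟨hij, hkl⟩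
    rw [SimpleGraph.sup_adj, SimpleGraph.edge_adj] at hij hkl
    rcases hij with hij | ⟨⟨rfl, rfl⟩ | ⟨rfl, rfl⟩, -⟩
    · rcases hkl with hkl | ⟨⟨rfl, rfl⟩ | ⟨rfl, rfl⟩, -⟩
      · exact hT.1 i k j l hik hkj hjl ⟨hij, hkl⟩
      · exact (h _ _ hij).2 ⟨hik, hkj, hjl⟩
      · exact absurd (hkj.trans hjl) hab.not_gt
    · rcases hkl with hkl | ⟨⟨rfl, rfl⟩ | ⟨rfl, rfl⟩, -⟩
      · exact (h _ _ hkl).1 ⟨hik, hkj, hjl⟩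
      · exact hik.false
      · exact absurd (hik.trans hkj) hjl.not_gt
    · exact absurd (hik.trans hkj) hab.not_gt
  exact hT.2 noncrossing le_sup_left
    (Or.inr ((SimpleGraph.edge_adj _ _ _ _).2 ⟨Or.inl ⟨rfl, rfl⟩, hab.ne⟩))

lemma adj_of_val_eq_succ (hT : IsTriangulation T) {a b : Fin (n + 1)}
    (hab : b.val = a.val + 1) : T.Adj a b :=
  hT.adj_of_forall_not_crossing (Fin.lt_def.2 (by omega)) fun x y _ => by
    simp only [Fin.lt_def]
    omega

lemma adj_zero_last (hT : IsTriangulation T) (hn : 0 < n) : T.Adj 0 (Fin.last n) :=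
  hT.adj_of_forall_not_crossing (Fin.lt_def.2 hn) fun x y _ =>
    ⟨fun h => h.2.2.not_ge (Fin.le_last y), fun h => h.1.not_ge (Fin.zero_le x)⟩

lemma eq_top {T : SimpleGraph (Fin (2 + 1))} (hT : IsTriangulation T) : T = ⊤ :=
  top_le_iff.1 (hT.2 (fun i k j l hik hkj hjl => by
    simp only [Fin.lt_def] at hik hkj hjl
    omega) le_top)

lemma exists_shorter_adj (hT : IsTriangulation T) {a b : Fin (n + 1)} (hab : T.Adj a b)
    (h : a.val + 2 < b.val) :
    ∃ x y : Fin (n + 1), T.Adj x y ∧ x.val + 2 ≤ y.val ∧ y.val - x.val < b.val - a.val := by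
  let p : Fin (n + 1) := ⟨a.val + 1, by omega⟩
  let c : Fin (n + 1) := ⟨a.val + 2, by omega⟩
  have ha : a < p := Fin.lt_def.2 (Nat.lt_succ_self _)
  have hpb : p < b := Fin.lt_def.2 (by simp only [p]; omega)
  by_cases hac : T.Adj a c
  · exact ⟨a, c, hac, le_rfl, by simp only [c]; omega⟩
  have crossing : ∃ x y, T.Adj x y ∧ ((a < x ∧ x < c ∧ c < y) ∨ (x < a ∧ a < y ∧ y < c)) := by
    by_contra! hcon
    exact hac (hT.adj_of_forall_not_crossing (Fin.lt_def.2 (by simp [c])) fun x y hxy =>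
      ⟨fun h => (hcon x y hxy).1 h.1 h.2.1 |>.not_gt h.2.2,
        fun h => (hcon x y hxy).2 h.1 h.2.1 |>.not_gt h.2.2⟩)
  obtain ⟨x, y, hxy, ⟨hax, hxc, hcy⟩ | ⟨hxa, hay, hyc⟩⟩ := crossing
  · obtain rfl : x = p := Fin.ext (by simp only [Fin.lt_def, c, p] at *; omega)
    have hyb : y ≤ b := not_lt.1 fun hby => hT.1 a p b y ha hpb hby ⟨hab, hxy⟩
    refine ⟨p, y, hxy, ?_, ?_⟩ <;> simp only [Fin.lt_def, Fin.le_def, c, p] at * <;> omega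
  · obtain rfl : y = p := Fin.ext (by simp only [Fin.lt_def, c, p] at *; omega)
    exact absurd ⟨hxy, hab⟩ (hT.1 x a p b hxa ha hpb)

lemma exists_adj_val_eq_add_two (hT : IsTriangulation T) {a b : Fin (n + 1)} (hab : T.Adj a b)
    (h : a.val + 2 ≤ b.val) : ∃ x y : Fin (n + 1), T.Adj x y ∧ y.val = x.val + 2 := by
  obtain h | h := h.eq_or_lt
  · exact ⟨a, b, hab, h.symm⟩
  · obtain ⟨x, y, hxy, hle, _⟩ := hT.exists_shorter_adj hab h
    exact hT.exists_adj_val_eq_add_two hxy hle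
termination_by b.val - a.val

end IsTriangulation

namespace Ear

variable {N : ℕ} (i : Fin N)

lemma val_triangle (j : Fin 3) : ((triangle i).toOrderHom j).val = i + j := by
  match j with
  | 0 | 1 | 2 => rfl

instance : Mono (edge i) :=
  SimplexCategory.mono_iff_injective.2 fun a b h => by
    match a, b with
    | 0, 0 | 1, 1 => rfl
    | 0, 1 => exact absurd h Fin.castSucc_lt_succ.ne
    | 1, 0 => exact absurd h Fin.castSucc_lt_succ.ne'

instance : Mono (triangle i) :=
  SimplexCategory.mono_iff_injective.2 fun a b h => Fin.ext (by
    have h := congrArg Fin.val h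
    rw [val_triangle, val_triangle] at h
    omega)

lemma face_ne_tip (k : Fin (N + 1)) : (face i).toOrderHom k ≠ (triangle i).toOrderHom 1 :=
  Fin.succAbove_ne _ k

end Ear

/-- The triangle `{i, i + 1, i + 2}` is an ear of the triangulation `T`: the diagonal that cuts it
off is an edge of `T`. -/
def HasEar {N : ℕ} (T : SimpleGraph (Fin (N + 1 + 1))) (i : Fin N) : Prop :=
  T.Adj ((Ear.triangle i).toOrderHom 0) ((Ear.triangle i).toOrderHom 2)

section HasEar

open Ear

variable {N : ℕ} {T : SimpleGraph (Fin (N + 1 + 1))} {i : Fin N}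

lemma IsTriangulation.exists_hasEar (hT : IsTriangulation T) (hN : 0 < N) : ∃ i, HasEar T i := by
  obtain ⟨a, b, hab, hb⟩ := hT.exists_adj_val_eq_add_two (hT.adj_zero_last N.succ_pos)
    (by simp only [Fin.val_zero, Fin.val_last]; omega)
  have hi : a.val < N := by omega
  obtain rfl : b = (triangle ⟨a, hi⟩).toOrderHom 2 := Fin.ext hb
  exact ⟨⟨a, hi⟩, hab⟩

namespace HasEar

lemma eq_of_adj_tip (h : HasEar T i) (hT : NonCrossing T) {q : Fin (N + 2)}
    (hq : T.Adj ((triangle i).toOrderHom 1) q) :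
    q = (triangle i).toOrderHom 0 ∨ q = (triangle i).toOrderHom 2 := by
  have lt_01 : (triangle i).toOrderHom 0 < (triangle i).toOrderHom 1 := Fin.castSucc_lt_succ
  have lt_12 : (triangle i).toOrderHom 1 < (triangle i).toOrderHom 2 := Fin.castSucc_lt_succ
  by_contra! hne
  obtain hlt | hgt : q < (triangle i).toOrderHom 0 ∨ (triangle i).toOrderHom 2 < q := by
    have hq := Fin.val_ne_of_ne hq.ne
    have h0 := Fin.val_ne_of_ne hne.1
    have h2 := Fin.val_ne_of_ne hne.2
    rw [Fin.lt_def, Fin.lt_def]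
    simp only [val_triangle, Fin.val_zero, Fin.val_one, Fin.val_two] at hq h0 h2 ⊢
    omega
  · exact hT _ _ _ _ hlt lt_01 lt_12 ⟨hq.symm, h⟩
  · exact hT _ _ _ _ lt_01 lt_12 hgt ⟨h, hq⟩

lemma adj_face_of_noncrossing (h : HasEar T i) (hT : IsTriangulation T)
    {G : SimpleGraph (Fin (N + 1))} (hG : NonCrossing G) (hle : T.comap (face i).toOrderHom ≤ G)
    {a b : Fin (N + 1)} (hab : a < b) (hadj : G.Adj a b) :
    T.Adj ((face i).toOrderHom a) ((face i).toOrderHom b) := by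
  have face_lt_iff (x y) : (face i).toOrderHom x < (face i).toOrderHom y ↔ x < y :=
    Fin.succAbove_lt_succAbove_iff
  have val_face_ne_tip (x) : ((face i).toOrderHom x).val ≠ i + 1 :=
    Fin.val_ne_of_ne (face_ne_tip i x)
  have val_ends {q} (hq : T.Adj ((triangle i).toOrderHom 1) q) :
      ((triangle i).toOrderHom 1).val = i + 1 ∧ (q.val = i ∨ q.val = i + 2) :=
    ⟨rfl, (h.eq_of_adj_tip hT.1 hq).imp (congrArg Fin.val) (congrArg Fin.val)⟩
  refine hT.adj_of_forall_not_crossing ((face_lt_iff a b).2 hab) fun x y hxy => ?_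
  obtain rfl | ⟨x, rfl⟩ := eq_tip_or_eq_face i x
  · have := val_ends hxy
    have := val_face_ne_tip a
    have := val_face_ne_tip b
    simp only [Fin.lt_def]
    omega
  · obtain rfl | ⟨y, rfl⟩ := eq_tip_or_eq_face i y
    · have := val_ends hxy.symm
      have := val_face_ne_tip a
      have := val_face_ne_tip b
      simp only [Fin.lt_def]
      omega
    · simp only [face_lt_iff]
      exact ⟨fun ⟨hax, hxb, hby⟩ => hG a x b y hax hxb hby ⟨hadj, hle hxy⟩,
        fun ⟨hxa, hay, hyb⟩ => hG x a y b hxa hay hyb ⟨hle hxy, hadj⟩⟩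

lemma isTriangulation_comap_face (h : HasEar T i) (hT : IsTriangulation T) :
    IsTriangulation (T.comap (face i).toOrderHom : SimpleGraph (Fin (N + 1))) := by
  have face_strictMono : StrictMono (face i).toOrderHom := Fin.strictMono_succAbove _
  refine ⟨fun a b c d hab hbc hcd => hT.1 _ _ _ _ (face_strictMono hab) (face_strictMono hbc)
    (face_strictMono hcd), fun G hG hle a b hab => ?_⟩
  obtain hlt | hgt := lt_or_gt_of_ne hab.ne
  · exact h.adj_face_of_noncrossing hT hG hle hlt hab
  · exact (h.adj_face_of_noncrossing hT hG hle hgt hab.symm).symm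

lemma isClique_range_triangle (h : HasEar T i) (hT : IsTriangulation T) :
    T.IsClique (Set.range (triangle i).toOrderHom) := by
  have adj_of_lt (a b : Fin 3) (hab : a < b) :
      T.Adj ((triangle i).toOrderHom a) ((triangle i).toOrderHom b) := by
    obtain hb | ⟨rfl, rfl⟩ : b.val = a.val + 1 ∨ a = 0 ∧ b = 2 := by omega
    · exact hT.adj_of_val_eq_succ (by rw [val_triangle, val_triangle, hb, Nat.add_assoc])
    · exact h
  rintro _ ⟨a, rfl⟩ _ ⟨b, rfl⟩ hab
  obtain hlt | hgt := lt_or_gt_of_ne (ne_of_apply_ne _ hab)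
  · exact adj_of_lt a b hlt
  · exact (adj_of_lt b a hgt).symm

lemma isClique_range_edge (h : HasEar T i) (hT : IsTriangulation T) :
    (T.comap (face i).toOrderHom : SimpleGraph (Fin (N + 1))).IsClique
      (Set.range (edge i).toOrderHom) := by
  rintro _ ⟨a, rfl⟩ _ ⟨b, rfl⟩ hab
  have mem_triangle (j : Fin 2) :
      (face i).toOrderHom ((edge i).toOrderHom j) ∈ Set.range (triangle i).toOrderHom :=
    ⟨chord.toOrderHom j, (congrArg (fun f => f.toOrderHom j) (edge_comp_face i)).symm⟩
  exact h.isClique_range_triangle hT (mem_triangle a) (mem_triangle b)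
    fun hab' => hab (Fin.succAbove_right_injective hab')

lemma subset_range_face_or_subset_range_triangle (h : HasEar T i) (hT : NonCrossing T)
    {S : Set (Fin (N + 2))} (hS : T.IsClique S) :
    S ⊆ Set.range (face i).toOrderHom ∨ S ⊆ Set.range (triangle i).toOrderHom := by
  by_cases htip : (triangle i).toOrderHom 1 ∈ S
  · refine Or.inr fun q hq => ?_
    by_cases hne : (triangle i).toOrderHom 1 = q
    · exact ⟨1, hne⟩
    · obtain rfl | rfl := h.eq_of_adj_tip hT (hS htip hq hne)
      exacts [⟨0, rfl⟩, ⟨2, rfl⟩]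
  · refine Or.inl fun q hq => ?_
    obtain rfl | ⟨k, rfl⟩ := eq_tip_or_eq_face i q
    exacts [absurd hq htip, ⟨k, rfl⟩]

end HasEar

lemma Ear.range_face_inter_range_triangle_subset :
    Set.range (face i).toOrderHom ∩ Set.range (triangle i).toOrderHom ⊆
      Set.range (edge i ≫ face i).toOrderHom := by
  rintro _ ⟨⟨a, ha⟩, b, rfl⟩
  match b with
  | 0 => exact ⟨0, face_edge_zero i⟩
  | 1 => exact absurd ha (face_ne_tip i a)
  | 2 => exact ⟨1, face_edge_one i⟩

end HasEar

/-! ### Gluing homotopy limits -/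

namespace HoLim

section

variable {J : Type w} [Category.{w} J] {K : J ⥤ Grpd.{v, u}}

instance {x y : HoLim K} (f : x ⟶ y) : IsIso f := by
  refine ⟨⟨⟨fun j => inv (f.app j), fun a => ?_⟩, ?_, ?_⟩⟩
  · rw [Functor.map_inv, IsIso.comp_inv_eq, Category.assoc, f.w, IsIso.inv_hom_id_assoc]
  · exact Hom.ext (funext fun j => IsIso.hom_inv_id (f.app j))
  · exact Hom.ext (funext fun j => IsIso.inv_hom_id (f.app j))

lemma iso_of_eq_id (z : HoLim K) {j : J} {a : j ⟶ j} (ha : a = 𝟙 j)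
    (h : (K.map a).obj (z.pt j) = z.pt j) : z.iso a = eqToHom h := by
  subst ha
  exact z.iso_id j

lemma iso_of_eq_comp (z : HoLim K) {i j k : J} {a : i ⟶ j} {b : j ⟶ k} {c : i ⟶ k}
    (hc : c = a ≫ b) (h : (K.map c).obj (z.pt i) = (K.map b).obj ((K.map a).obj (z.pt i))) :
    z.iso c = eqToHom h ≫ (K.map b).map (z.iso a) ≫ z.iso b := by
  subst hc
  exact z.iso_comp a b

variable (K) in
/-- Restriction of homotopy limits along a functor between the index categories. -/
def reindex {J' : Type w} [Category.{w} J'] (Φ : J' ⥤ J) : HoLim K ⥤ HoLim (Φ ⋙ K) where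
  obj z :=
    { pt := fun j => z.pt (Φ.obj j)
      iso := fun a => z.iso (Φ.map a)
      iso_id := fun j => z.iso_of_eq_id (Φ.map_id j) _
      iso_comp := fun a b => z.iso_of_eq_comp (Φ.map_comp a b) _ }
  map f :=
    { app := fun j => f.app (Φ.obj j)
      w := fun a => f.w (Φ.map a) }

variable (K) in
/-- The projection of a homotopy limit to the groupoid at `j`. -/
def ev (j : J) : HoLim K ⥤ K.obj j where
  obj z := z.pt j
  map f := f.app j

variable (K) in
/-- The structure isomorphisms of the points of a homotopy limit, as an isomorphism of functors. -/
noncomputable def evIso {i j : J} (a : i ⟶ j) : ev K i ⋙ K.map a ≅ ev K j :=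
  NatIso.ofComponents (fun z => (Groupoid.isoEquivHom _ _).symm (z.iso a)) fun f => (f.w a).symm

end

variable {J : Type w} [Category.{w} J] {K : Jᵒᵖ ⥤ Grpd.{v, u}} {x y : HoLim K}

/-- The component at `i` that naturality along `a : i ⟶ j` forces on a morphism `x ⟶ y` of
homotopy limits with component `f` at `j`. -/
noncomputable def restr {i j : J} (a : i ⟶ j) (f : x.pt (op j) ⟶ y.pt (op j)) :
    x.pt (op i) ⟶ y.pt (op i) :=
  inv (x.iso a.op) ≫ (K.map a.op).map f ≫ y.iso a.op

lemma restr_id {i : J} (f : x.pt (op i) ⟶ y.pt (op i)) : restr (𝟙 i) f = f := by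
  rw [restr, IsIso.inv_comp_eq]
  have hx : x.iso (𝟙 i).op = eqToHom _ := x.iso_id (op i)
  have hy : y.iso (𝟙 i).op = eqToHom _ := y.iso_id (op i)
  rw [hx, hy]
  exact (eqToHom_comp_map (K.map_id (op i)) f).symm

lemma restr_comp {i j k : J} (a : i ⟶ j) (b : j ⟶ k) (f : x.pt (op k) ⟶ y.pt (op k)) :
    restr (a ≫ b) f = restr a (restr b f) := by
  rw [restr, IsIso.inv_comp_eq]
  have hx : x.iso (a ≫ b).op = _ := x.iso_comp b.op a.op
  have hy : y.iso (a ≫ b).op = _ := y.iso_comp b.op a.op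
  have hf := eqToHom_comp_map (K.map_comp b.op a.op) f
  have ha := IsIso.hom_inv_id_assoc (x.iso a.op)
    ((K.map a.op).map (restr b f) ≫ y.iso a.op)
  have hbf : (K.map a.op).map (x.iso b.op) ≫ (K.map a.op).map (restr b f) =
      (K.map a.op).map ((K.map b.op).map f) ≫ (K.map a.op).map (y.iso b.op) := by
    rw [← Functor.map_comp, ← Functor.map_comp, restr, IsIso.hom_inv_id_assoc]
  change (K.map (b.op ≫ a.op)).map f ≫ y.iso (a ≫ b).op = x.iso (a ≫ b).op ≫ restr a (restr b f)
  rw [hx, hy, Category.assoc, Category.assoc, restr, ha, ← Category.assoc ((K.map a.op).map _), hbf,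
    Category.assoc, ← Category.assoc ((K.map (b.op ≫ a.op)).map f), ← hf, Category.assoc]
  rfl

lemma Hom.app_eq_restr (f : x ⟶ y) {i j : J} (a : i ⟶ j) :
    f.app (op i) = restr a (f.app (op j)) := by
  rw [restr, ← f.w, IsIso.inv_hom_id_assoc]

/-- A morphism of homotopy limits, given by a family of components compatible with `restr`. -/
def homOfRestr (p : ∀ i : J, x.pt (op i) ⟶ y.pt (op i))
    (hp : ∀ {i j : J} (a : i ⟶ j), p i = restr a (p j)) : x ⟶ y where
  app i := p i.unop
  w {i j} a := by
    rw [hp a.unop]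
    exact IsIso.hom_inv_id_assoc _ _

lemma ev_full_of_isTerminal {t : J} (ht : IsTerminal t) : (ev K (op t)).Full :=
  ⟨fun g => ⟨homOfRestr (fun i => restr (ht.from i) g)
    fun a => (congrArg (restr · g) (ht.hom_ext _ _)).trans (restr_comp a _ g),
    (congrArg (restr · g) (ht.hom_ext _ _)).trans (restr_id g)⟩⟩

lemma ev_faithful_of_isTerminal {t : J} (ht : IsTerminal t) : (ev K (op t)).Faithful where
  map_injective {_ _ f g} h := Hom.ext (funext fun i =>
    (f.app_eq_restr (ht.from i.unop)).trans
      ((congrArg (restr (ht.from i.unop)) h).trans (g.app_eq_restr (ht.from i.unop)).symm))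

end HoLim

/-- The category `J` is glued from `J'` and the object `t` along the object `e` of `J'`: every
object of `J` maps to the image of `Φ : J' ⥤ J` or to `t`, and those which map to both map to
`Φ.obj e`. -/
structure IsGluing {J J' : Type w} [Category.{w} J] [Category.{w} J'] (Φ : J' ⥤ J) {e : J'} {t : J}
    (δ : Φ.obj e ⟶ t) : Prop where
  cover : ∀ i, (∃ k, Nonempty (i ⟶ Φ.obj k)) ∨ Nonempty (i ⟶ t)
  exists_factor : ∀ {i : J} {k l : J'} (a : i ⟶ Φ.obj k) (b : i ⟶ Φ.obj l),
    ∃ (m : J') (s : i ⟶ Φ.obj m) (a' : m ⟶ k) (b' : m ⟶ l), s ≫ Φ.map a' = a ∧ s ≫ Φ.map b' = b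
  hom_ext : ∀ {i : J} (a b : i ⟶ t), a = b
  overlap : ∀ {i : J} {k : J'} (_ : i ⟶ Φ.obj k) (_ : i ⟶ t), Nonempty (i ⟶ Φ.obj e)

namespace IsGluing

open HoLim

variable {J J' : Type w} [Category.{w} J] [Category.{w} J'] {Φ : J' ⥤ J} {e : J'} {t : J}
  {δ : Φ.obj e ⟶ t} {K : Jᵒᵖ ⥤ Grpd.{v, u}} {x y : HoLim K}

lemma restr_eq_restr (H : IsGluing Φ δ)
    {f : ∀ k, x.pt (op (Φ.obj k)) ⟶ y.pt (op (Φ.obj k))}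
    (hf : ∀ {k l : J'} (a : k ⟶ l), f k = restr (Φ.map a) (f l))
    {i : J} {k l : J'} (a : i ⟶ Φ.obj k) (b : i ⟶ Φ.obj l) : restr a (f k) = restr b (f l) := by
  obtain ⟨m, s, a', b', rfl, rfl⟩ := H.exists_factor a b
  rw [restr_comp, restr_comp, ← hf, ← hf]

lemma exists_component (H : IsGluing Φ δ) {f : ∀ k, x.pt (op (Φ.obj k)) ⟶ y.pt (op (Φ.obj k))}
    (hf : ∀ {k l : J'} (a : k ⟶ l), f k = restr (Φ.map a) (f l))
    {g : x.pt (op t) ⟶ y.pt (op t)} (hfg : f e = restr δ g) (i : J) :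
    ∃ p : x.pt (op i) ⟶ y.pt (op i),
      (∀ (k : J') (a : i ⟶ Φ.obj k), p = restr a (f k)) ∧ ∀ a : i ⟶ t, p = restr a g := by
  by_cases hi : ∃ k, Nonempty (i ⟶ Φ.obj k)
  · obtain ⟨k, ⟨a⟩⟩ := hi
    refine ⟨restr a (f k), fun l b => H.restr_eq_restr hf a b, fun b => ?_⟩
    obtain ⟨s⟩ := H.overlap a b
    rw [H.hom_ext b (s ≫ δ), restr_comp, ← hfg, H.restr_eq_restr hf a s]
  · obtain ⟨b⟩ := (H.cover i).resolve_left hi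
    exact ⟨restr b g, fun k a => absurd ⟨k, ⟨a⟩⟩ hi, fun b' => by rw [H.hom_ext b' b]⟩

lemma exists_hom (H : IsGluing Φ δ) {f : ∀ k, x.pt (op (Φ.obj k)) ⟶ y.pt (op (Φ.obj k))}
    (hf : ∀ {k l : J'} (a : k ⟶ l), f k = restr (Φ.map a) (f l))
    {g : x.pt (op t) ⟶ y.pt (op t)} (hfg : f e = restr δ g) :
    ∃ h : x ⟶ y, (∀ k, h.app (op (Φ.obj k)) = f k) ∧ h.app (op t) = g := by
  choose p p_eq_f p_eq_g using H.exists_component hf hfg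
  have hp {i j : J} (a : i ⟶ j) : p i = restr a (p j) := by
    obtain ⟨k, ⟨b⟩⟩ | ⟨⟨b⟩⟩ := H.cover j
    · rw [p_eq_f i k (a ≫ b), p_eq_f j k b, restr_comp]
    · rw [p_eq_g i (a ≫ b), p_eq_g j b, restr_comp]
  exact ⟨homOfRestr p hp, fun k => (p_eq_f _ k (𝟙 _)).trans (restr_id _),
    (p_eq_g t (𝟙 t)).trans (restr_id g)⟩

lemma holim_hom_ext (H : IsGluing Φ δ) {f g : x ⟶ y}
    (hΦ : ∀ k, f.app (op (Φ.obj k)) = g.app (op (Φ.obj k)))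
    (ht : f.app (op t) = g.app (op t)) : f = g := by
  refine Hom.ext (funext fun ⟨i⟩ => ?_)
  obtain ⟨k, ⟨a⟩⟩ | ⟨⟨a⟩⟩ := H.cover i
  · rw [f.app_eq_restr a, g.app_eq_restr a, hΦ]
  · rw [f.app_eq_restr a, g.app_eq_restr a, ht]

lemma isFullyFaithfulSquare (H : IsGluing Φ δ) (K : Jᵒᵖ ⥤ Grpd.{v, u}) :
    IsFullyFaithfulSquare (P := reindex K Φ.op) (Q := ev K (op t)) (f := ev (Φ.op ⋙ K) (op e))
      (g := K.map δ.op) (evIso K δ.op).symm where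
  exists_hom {x y} f g hfg := by
    have hδ : f.app (op e) = restr (x := x) (y := y) δ g := (IsIso.eq_inv_comp (x.iso δ.op)).2
      ((Iso.eq_inv_comp ((evIso K δ.op).app x)).1
        (((Iso.comp_inv_eq ((evIso K δ.op).app y)).1 hfg).trans (Category.assoc _ _ _)))
    obtain ⟨h, hf, hg⟩ := H.exists_hom (fun a => f.app_eq_restr a) hδ
    exact ⟨h, Hom.ext (funext fun k => hf k.unop), hg⟩
  hom_ext hΦ ht :=
    H.holim_hom_ext (fun k => congrArg (fun h : Hom _ _ => h.app (op k)) hΦ) ht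

end IsGluing

/-! ### The 2-Segal property -/

section Simplices

variable {k m n : SimplexCategory}

lemma exists_comp_eq_of_range_subset (α : k ⟶ n) (β : m ⟶ n) [Mono β]
    (h : Set.range α.toOrderHom ⊆ Set.range β.toOrderHom) : ∃ γ : k ⟶ m, γ ≫ β = α := by
  have hβ : StrictMono β.toOrderHom :=
    β.toOrderHom.monotone.strictMono_of_injective (SimplexCategory.mono_iff_injective.1 ‹_›)
  choose γ hγ using fun j => h ⟨j, rfl⟩
  refine ⟨SimplexCategory.mkHom ⟨γ, fun a b hab => hβ.le_iff_le.1 ?_⟩, ?_⟩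
  · rw [hγ, hγ]
    exact α.toOrderHom.monotone hab
  · ext j : 3
    exact hγ j

namespace Simplices

variable {m n : ℕ} {T : SimpleGraph (Fin (n + 1))}

/-- The simplex of `T` given by a monotone map whose image is a clique. -/
abbrev mk (α : SimplexCategory.mk m ⟶ SimplexCategory.mk n)
    (h : T.IsClique (Set.range α.toOrderHom)) : Simplices T :=
  ⟨Over.mk α, h⟩

/-- The morphism of simplices of `T` given by a monotone map over `[n]`. -/
abbrev homMk {σ ρ : Simplices T} (a : σ.obj.left ⟶ ρ.obj.left) (h : a ≫ ρ.obj.hom = σ.obj.hom) :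
    σ ⟶ ρ :=
  ObjectProperty.homMk (Over.homMk a h)

lemma hom_ext_of_mono {σ ρ : Simplices T} [Mono ρ.obj.hom] (a b : σ ⟶ ρ) : a = b :=
  ObjectProperty.hom_ext _ (Over.OverMorphism.ext
    ((cancel_mono ρ.obj.hom).1 ((Over.w a.hom).trans (Over.w b.hom).symm)))

variable (T) in
/-- Composition with `α : [m] ⟶ [n]`, from the simplices of the restriction of the graph `T` along
`α` to the simplices of `T`. -/
def push (α : SimplexCategory.mk m ⟶ SimplexCategory.mk n) :
    Simplices (T.comap α.toOrderHom : SimpleGraph (Fin (m + 1))) ⥤ Simplices T :=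
  ObjectProperty.lift _ (ObjectProperty.ι _ ⋙ Over.map α) (by
    rintro ⟨σ, hσ⟩ _ ⟨a, rfl⟩ _ ⟨b, rfl⟩ hab
    exact hσ ⟨a, rfl⟩ ⟨b, rfl⟩ fun h => hab (congrArg α.toOrderHom h))

lemma nonempty_hom_of_range_subset (σ ρ : Simplices T) [Mono ρ.obj.hom]
    (h : Set.range σ.obj.hom.toOrderHom ⊆ Set.range ρ.obj.hom.toOrderHom) : Nonempty (σ ⟶ ρ) := by
  obtain ⟨γ, hγ⟩ := exists_comp_eq_of_range_subset σ.obj.hom ρ.obj.hom h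
  exact ⟨homMk γ hγ⟩

variable {α : SimplexCategory.mk m ⟶ SimplexCategory.mk n} [Mono α]

lemma exists_hom_push_of_range_subset (σ : Simplices T)
    (h : Set.range σ.obj.hom.toOrderHom ⊆ Set.range α.toOrderHom) :
    ∃ k, Nonempty (σ ⟶ (push T α).obj k) := by
  obtain ⟨γ, hγ⟩ := exists_comp_eq_of_range_subset σ.obj.hom α h
  have γ_clique : (T.comap α.toOrderHom : SimpleGraph (Fin (m + 1))).IsClique
      (Set.range γ.toOrderHom) := by
    rintro _ ⟨a, rfl⟩ _ ⟨b, rfl⟩ hab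
    have apply_γ (j) : σ.obj.hom.toOrderHom j = α.toOrderHom (γ.toOrderHom j) :=
      congrArg (fun f => f.toOrderHom j) hγ.symm
    exact σ.property ⟨a, apply_γ a⟩ ⟨b, apply_γ b⟩
      fun h => hab (SimplexCategory.mono_iff_injective.1 ‹Mono α› h)
  exact ⟨mk γ γ_clique, ⟨homMk (𝟙 _) ((Category.id_comp _).trans hγ)⟩⟩

lemma push_exists_factor {σ : Simplices T}
    {k l : Simplices (T.comap α.toOrderHom : SimpleGraph (Fin (m + 1)))}
    (a : σ ⟶ (push T α).obj k) (b : σ ⟶ (push T α).obj l) :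
    ∃ (r : Simplices (T.comap α.toOrderHom : SimpleGraph (Fin (m + 1))))
      (s : σ ⟶ (push T α).obj r) (a' : r ⟶ k) (b' : r ⟶ l),
      s ≫ (push T α).map a' = a ∧ s ≫ (push T α).map b' = b := by
  have hk : (a.hom.left ≫ k.obj.hom) ≫ α = σ.obj.hom :=
    (Category.assoc _ _ _).trans (Over.w a.hom)
  have hl : (b.hom.left ≫ l.obj.hom) ≫ α = σ.obj.hom :=
    (Category.assoc _ _ _).trans (Over.w b.hom)
  have hkl : b.hom.left ≫ l.obj.hom = a.hom.left ≫ k.obj.hom :=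
    (cancel_mono α).1 (hl.trans hk.symm)
  have r_clique : (T.comap α.toOrderHom : SimpleGraph (Fin (m + 1))).IsClique
      (Set.range (a.hom.left ≫ k.obj.hom).toOrderHom) :=
    k.property.subset
      (Set.range_comp_subset_range a.hom.left.toOrderHom k.obj.hom.toOrderHom)
  exact ⟨mk (a.hom.left ≫ k.obj.hom) r_clique, homMk (𝟙 _) ((Category.id_comp _).trans hk),
    homMk a.hom.left rfl, homMk b.hom.left hkl,
    ObjectProperty.hom_ext _ (Over.OverMorphism.ext (Category.id_comp _)),
    ObjectProperty.hom_ext _ (Over.OverMorphism.ext (Category.id_comp _))⟩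

end Simplices

section TwoSegalMap

variable {m n : ℕ} (X : SimplicialObject Grpd.{v, u})
  (α : SimplexCategory.mk m ⟶ SimplexCategory.mk n) (T : SimpleGraph (Fin (n + 1)))

lemma eqToHom_comp_eqToHom_eq_map_comp {C D : Type*} [Category C] [Category D] (G : C ⥤ D)
    {x y : C} {z t : D} (h₁ : G.obj x = z) (h₂ : z = t) (h₃ : x = y) (h₄ : G.obj y = t) :
    eqToHom h₁ ≫ eqToHom h₂ = G.map (eqToHom h₃) ≫ eqToHom h₄ := by
  rw [eqToHom_map, eqToHom_trans, eqToHom_trans]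

lemma map_comp_map_simplex
    (σ : Simplices (T.comap α.toOrderHom : SimpleGraph (Fin (m + 1)))) :
    X.map α.op ⋙ X.map σ.obj.hom.op = X.map ((Simplices.push T α).obj σ).obj.hom.op :=
  (X.map_comp α.op (Quiver.Hom.op (Y := SimplexCategory.mk m) σ.obj.hom)).symm

/-- The comparison of the two-Segal maps of `T` and of its restriction along `α`. -/
noncomputable def twoSegalMapPushIso :
    X.map α.op ⋙ twoSegalMap X (T.comap α.toOrderHom : SimpleGraph (Fin (m + 1))) ≅
      twoSegalMap X T ⋙ HoLim.reindex (simplexDiagram X T) (Simplices.push T α).op :=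
  NatIso.ofComponents
    (fun x => asIso
      { app := fun σ => eqToHom (Functor.congr_obj (map_comp_map_simplex X α T σ.unop) x)
        w := fun a => eqToHom_comp_eqToHom_eq_map_comp (X.map a.unop.hom.left.op)
          (Functor.congr_obj (simplexDiagram_obj_map X _ a) ((X.map α.op).obj x)) _ _
          (Functor.congr_obj
            (simplexDiagram_obj_map X T ((Simplices.push T α).op.map a)) x) })
    fun f => HoLim.Hom.ext (funext fun σ =>
      (eqToHom_comp_map (map_comp_map_simplex X α T σ.unop) f).symm)

end TwoSegalMap

end Simplices

lemma isEquivalence_twoSegalMap_top (X : SimplicialObject Grpd.{v, u}) (n : ℕ) :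
    (twoSegalMap X (⊤ : SimpleGraph (Fin (n + 1)))).IsEquivalence := by
  let t : Simplices (⊤ : SimpleGraph (Fin (n + 1))) :=
    Simplices.mk (𝟙 (SimplexCategory.mk n)) fun _ _ _ _ h => h
  have ht : IsTerminal t := IsTerminal.ofUniqueHom
    (fun σ => Simplices.homMk σ.obj.hom (Category.comp_id _))
    fun σ a => ObjectProperty.hom_ext _
      (Over.OverMorphism.ext ((Category.comp_id _).symm.trans (Over.w a.hom)))
  have comp_ev : twoSegalMap X ⊤ ⋙ HoLim.ev (simplexDiagram X ⊤) (op t) = 𝟭 _ := X.map_id _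
  have comp_ev_equiv : (twoSegalMap X ⊤ ⋙ HoLim.ev (simplexDiagram X ⊤) (op t)).IsEquivalence := by
    rw [comp_ev]
    exact inferInstanceAs (𝟭 (X.obj (op (SimplexCategory.mk n)))).IsEquivalence
  have ev_equiv : (HoLim.ev (simplexDiagram X ⊤) (op t)).IsEquivalence :=
    { full := HoLim.ev_full_of_isTerminal ht
      faithful := HoLim.ev_faithful_of_isTerminal ht
      essSurj := ⟨fun z => ⟨(twoSegalMap X ⊤).obj z, ⟨eqToIso (Functor.congr_obj comp_ev z)⟩⟩⟩ }
  exact Functor.isEquivalence_of_comp_right _ (HoLim.ev (simplexDiagram X ⊤) (op t))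

namespace HasEar

variable {N : ℕ} {T : SimpleGraph (Fin (N + 1 + 1))} {i : Fin N}

/-- The ear, as a simplex of the triangulation. -/
abbrev triangleSimplex (h : HasEar T i) (hT : IsTriangulation T) : Simplices T :=
  Simplices.mk (Ear.triangle i) (h.isClique_range_triangle hT)

/-- The edge along which the ear is attached, as a simplex of the remaining triangulation. -/
abbrev edgeSimplex (h : HasEar T i) (hT : IsTriangulation T) :
    Simplices (T.comap (Ear.face i).toOrderHom : SimpleGraph (Fin (N + 1))) :=
  Simplices.mk (Ear.edge i) (h.isClique_range_edge hT)

/-- The inclusion of the edge along which the ear is attached into the ear. -/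
abbrev chordHom (h : HasEar T i) (hT : IsTriangulation T) :
    (Simplices.push T (Ear.face i)).obj (h.edgeSimplex hT) ⟶ h.triangleSimplex hT :=
  Simplices.homMk Ear.chord (Ear.edge_comp_face i).symm

lemma isGluing_chordHom (h : HasEar T i) (hT : IsTriangulation T) :
    IsGluing (Simplices.push T (Ear.face i)) (h.chordHom hT) := by
  have triangle_mono : Mono (h.triangleSimplex hT).obj.hom :=
    inferInstanceAs (Mono (Ear.triangle i))
  have edge_mono : Mono ((Simplices.push T (Ear.face i)).obj (h.edgeSimplex hT)).obj.hom :=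
    inferInstanceAs (Mono (Ear.edge i ≫ Ear.face i))
  refine ⟨fun σ => (h.subset_range_face_or_subset_range_triangle hT.1 σ.property).imp
    σ.exists_hom_push_of_range_subset (σ.nonempty_hom_of_range_subset _),
    Simplices.push_exists_factor, Simplices.hom_ext_of_mono, fun {σ k} a b => ?_⟩
  refine σ.nonempty_hom_of_range_subset _ fun j hj =>
    Ear.range_face_inter_range_triangle_subset ⟨?_, ?_⟩
  · rw [← Over.w a.hom] at hj
    exact Set.range_comp_subset_range (a.hom.left ≫ k.obj.hom).toOrderHom _ hj
  · rw [← Over.w b.hom] at hj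
    exact Set.range_comp_subset_range b.hom.left.toOrderHom _ hj

lemma isEquivalence_twoSegalMap {X : SimplicialObject Grpd.{v, u}} (hX : IsEarLocal X)
    (h : HasEar T i) (hT : IsTriangulation T)
    [(twoSegalMap X
      (T.comap (Ear.face i).toOrderHom : SimpleGraph (Fin (N + 1)))).IsEquivalence] :
    (twoSegalMap X T).IsEquivalence :=
  (hX i).isEquivalence_of_comparison
    (M := twoSegalMap X (T.comap (Ear.face i).toOrderHom : SimpleGraph (Fin (N + 1))))
    ((h.isGluing_chordHom hT).isFullyFaithfulSquare (simplexDiagram X T))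
    (twoSegalMapPushIso X (Ear.face i) T) fun x =>
      (Iso.eq_comp_inv ((HoLim.evIso _ (h.chordHom hT).op).app ((twoSegalMap X T).obj x))).2
        ((congrArg (· ≫ _) (eqToHom_app (map_comp_map_eq X (Ear.edge_comp_face i)) x)).trans
          (eqToHom_trans _
            (Functor.congr_obj (simplexDiagram_obj_map X T (h.chordHom hT).op) x)))

end HasEar

theorem isTwoSegal_of_isEarLocal {X : SimplicialObject Grpd.{v, u}} (hX : IsEarLocal X) :
    IsTwoSegal X := by
  intro n hn
  induction n, hn using Nat.le_induction with
  | base =>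
    intro T hT
    rw [hT.eq_top]
    exact isEquivalence_twoSegalMap_top X 2
  | succ N hN ih =>
    intro T hT
    obtain ⟨i, hi⟩ := hT.exists_hasEar (by omega)
    have := ih _ (hi.isTriangulation_comap_face hT)
    exact hi.isEquivalence_twoSegalMap hX hT

end RelSdot

theorem mainTheorem12 {A B : Type u}
    [Category.{v} A] [Preadditive A] [HasFiniteBiproducts A] [RelSdot.ExactCategory A]
    [Category.{v} B] [Preadditive B] [HasFiniteBiproducts B] [RelSdot.ExactCategory B]
    (F : A ⥤ B) [RelSdot.ExactFunctor F] :
    RelSdot.IsTwoSegal (RelSdot.relSdot F) :=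
  RelSdot.isTwoSegal_of_isEarLocal (RelSdot.isEarLocal_relSdot F)
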